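/- Let $\mathcal S=\{S^i\}_{i=1}^d$ be a finite family of $d\ge 1$ finite sets, $J:=\bigcup_{i=1}^d S^i$ and $n:=|J|$. Let $\operatorname{CDC}(\mathcal S)=\bigcup_{S\in\mathcal S}\{\lambda\in\mathbb R^J:\lambda\ge 0,\ \sum_{v\in J}\lambda_v=1,\ \lambda_v=0 \text{ for } v\in J\setminus S\}$ be the combinatorial disjunctive constraint represented by $\mathcal S$. Its *intersection graph* $\mathcal K_{\mathcal S}$ is the complete graph on the vertices $S^1,\dots,S^d$ (one vertex for each index), in which an edge $e=S^iS^j$ has the *middle set* $\operatorname{mid}(e):=S^i\cap S^j$ and the weight $w(e):=|\operatorname{mid}(e)|$. A *maximum spanning tree* is a spanning tree of $\mathcal K_{\mathcal S}$ of largest total weight. A *junction tree* of $\operatorname{CDC}(\mathcal S)$ is a spanning tree $\mathcal T$ of $\mathcal K_{\mathcal S}$ such that for all $i,j$ every vertex $S$ and every edge $e$ on the path between $S^i$ and $S^j$ in $\mathcal T$ satisfies $S^i\cap S^j\subseteq S$ and $S^i\cap S^j\subseteq\operatorname{mid}(e)$. A spanning tree $\mathcal T$ satisfies the *separation condition* if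 for each edge $e$ of $\mathcal T$, with $\mathcal S_1,\mathcal S_2$ the vertex sets of the two components of $\mathcal T\setminus e$, $$\Big(\bigcup_{S\in\mathcal S_1}S\Big)\cap\Big(\bigcup_{S\in\mathcal S_2}S\Big)\subseteq\operatorname{mid}(e).$$ Then it is possible to determine whether $\operatorname{CDC}(\mathcal S)$ admits a junction tree in time polynomial in $d$ and $n$: compute one maximum spanning tree of $\mathcal K_{\mathcal S}$ and check whether it satisfies the separation condition. Precisely, there are a polynomial $P$ and two programs for a random access machine (registers and indirectly addressed memory holding natural numbers; addition, truncated subtraction, and zero tests; unit cost for each instruction and each test), none of which depends on $\mathcal S$, such that for each $\mathcal S$ as above, given by $d$, $n$ and its $d\times n$ incidence matrix with respect to any enumeration of $J$: 1. running the first program and then the second one on this input halts after at most $P(d,n)$ steps in total, with output $1$ if $\operatorname{CDC}(\mathcal S)$ admits a junction tree and $0$ otherwise; 2. the first program, on this input, computes a maximum spanning tree of $\mathcal K_{\mathcal S}$ (as an adjacency matrix) in at most $P(d,n)$ steps; 3. the second program, given $\mathcal S$ and any spanning tree $\mathcal T$ of $\mathcal K_{\mathcal S}$, decides in at most $P(d,n)$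 steps whether $\mathcal T$ satisfies the separation condition; 4. for each maximum spanning tree $\mathcal T$ of $\mathcal K_{\mathcal S}$, $\operatorname{CDC}(\mathcal S)$ admits a junction tree if and only if $\mathcal T$ satisfies the separation condition. -/

import Mathlib

/-! ## Junction trees of a finite family of finite sets

A combinatorial disjunctive constraint is given by a finite family `S : ι → Finset α`.  The vertices
of all graphs below are the indices, the vertex `i` standing for the set `S i`. -/

namespace CDC

variable {ι α : Type*} [DecidableEq α]

/-- The middle set of the edge joining `i` and `j` is `S i ∩ S j`. -/
def mid (S : ι → Finset α) : Sym2 ι → Finset α :=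
  Sym2.lift ⟨fun i j => S i ∩ S j, fun i j => Finset.inter_comm (S i) (S j)⟩

/-- The (complete) intersection graph: any two distinct members of the family are joined. -/
def intersectionGraph (_S : ι → Finset α) : SimpleGraph ι := ⊤

/-- Spanning trees of the intersection graph. -/
def IsSpanningTree (S : ι → Finset α) (T : SimpleGraph ι) : Prop :=
  T ≤ intersectionGraph S ∧ T.IsTree

open Classical in
/-- The weight of a graph: the sum over its edges of the cardinality of the middle set. -/
noncomputable def weight [Fintype ι] (S : ι → Finset α) (T : SimpleGraph ι) : ℕ :=
  ∑ e ∈ T.edgeFinset, (mid S e).card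

/-- Maximum spanning trees of the intersection graph. -/
def IsMaxSpanningTree [Fintype ι] (S : ι → Finset α) (T : SimpleGraph ι) : Prop :=
  IsSpanningTree S T ∧ ∀ T' : SimpleGraph ι, IsSpanningTree S T' → weight S T' ≤ weight S T

/-- `T` is a junction tree: it is a spanning tree, and on the path between any two vertices `i` and
`j` every vertex and every middle set of an edge contains `S i ∩ S j`. -/
def IsJunctionTree (S : ι → Finset α) (T : SimpleGraph ι) : Prop :=
  IsSpanningTree S T ∧ ∀ (i j : ι) (p : T.Walk i j), p.IsPath →
    (∀ k ∈ p.support, S i ∩ S j ⊆ S k) ∧ (∀ e ∈ p.edges, S i ∩ S j ⊆ mid S e)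

/-- The constraint given by `S` admits a junction tree. -/
def AdmitsJunctionTree (S : ι → Finset α) : Prop :=
  ∃ T : SimpleGraph ι, IsJunctionTree S T

/-- The separation condition: for each edge `e` of `T`, an element that lies in sets from both of the
components of `T` with `e` removed belongs to the middle set of `e`. -/
def SeparationCondition (S : ι → Finset α) (T : SimpleGraph ι) : Prop :=
  ∀ e ∈ T.edgeSet, ∀ C₁ C₂ : (T.deleteEdges {e}).ConnectedComponent, C₁ ≠ C₂ →
    (⋃ k ∈ C₁.supp, (S k : Set α)) ∩ (⋃ l ∈ C₂.supp, (S l : Set α)) ⊆ (mid S e : Set α)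

end CDC

/-! ## Random access machines

Machines with registers and an indirectly addressed memory, all holding natural numbers, with
addition, truncated subtraction and tests for zero as the only arithmetic.  Every instruction that
is executed and every test costs one step.  There is no multiplication, so that a number computed
in `t` steps has at most `t` bits more than the numbers present at the start. -/

namespace RAM

/-- The contents of the registers and of the memory. -/
@[ext] structure State where
  reg : ℕ → ℕ
  mem : ℕ → ℕ

/-- Programs. -/
inductive Prog : Type
  /-- register `r` := the constant `k` -/
  | const (r k : ℕ) : Prog
  /-- register `r` := register `a` + register `b` -/
  | add (r a b : ℕ) : Prog
  /-- register `r` := register `a` - register `b`, or zero if that is negative -/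
  | sub (r a b : ℕ) : Prog
  /-- register `r` := the memory cell whose address is in register `a` -/
  | load (r a : ℕ) : Prog
  /-- the memory cell whose address is in register `a` := register `b` -/
  | store (a b : ℕ) : Prog
  /-- run `p`, then `q` -/
  | seq (p q : Prog) : Prog
  /-- run `p` if register `r` is non-zero, and `q` otherwise -/
  | ite (r : ℕ) (p q : Prog) : Prog
  /-- as long as register `r` is non-zero, run `p` -/
  | loop (r : ℕ) (p : Prog) : Prog

/-- Change one register. -/
def State.setReg (s : State) (r v : ℕ) : State := ⟨Function.update s.reg r v, s.mem⟩

/-- Change one memory cell. -/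
def State.setMem (s : State) (a v : ℕ) : State := ⟨s.reg, Function.update s.mem a v⟩

/-- `Exec p s t s'`: started in state `s`, the program `p` halts after exactly `t` steps in
state `s'`. -/
inductive Exec : Prog → State → ℕ → State → Prop
  | const (r k : ℕ) (s : State) : Exec (.const r k) s 1 (s.setReg r k)
  | add (r a b : ℕ) (s : State) : Exec (.add r a b) s 1 (s.setReg r (s.reg a + s.reg b))
  | sub (r a b : ℕ) (s : State) : Exec (.sub r a b) s 1 (s.setReg r (s.reg a - s.reg b))
  | load (r a : ℕ) (s : State) : Exec (.load r a) s 1 (s.setReg r (s.mem (s.reg a)))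
  | store (a b : ℕ) (s : State) : Exec (.store a b) s 1 (s.setMem (s.reg a) (s.reg b))
  | seq {p q : Prog} {s s₁ s₂ : State} {t₁ t₂ : ℕ} :
      Exec p s t₁ s₁ → Exec q s₁ t₂ s₂ → Exec (.seq p q) s (t₁ + t₂) s₂
  | ite_true {r : ℕ} {p q : Prog} {s s₁ : State} {t : ℕ} :
      s.reg r ≠ 0 → Exec p s t s₁ → Exec (.ite r p q) s (t + 1) s₁
  | ite_false {r : ℕ} {p q : Prog} {s s₁ : State} {t : ℕ} :
      s.reg r = 0 → Exec q s t s₁ → Exec (.ite r p q) s (t + 1) s₁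
  | loop_stop {r : ℕ} {p : Prog} {s : State} :
      s.reg r = 0 → Exec (.loop r p) s 1 s
  | loop_step {r : ℕ} {p : Prog} {s s₁ s₂ : State} {t₁ t₂ : ℕ} :
      s.reg r ≠ 0 → Exec p s t₁ s₁ → Exec (.loop r p) s₁ t₂ s₂ →
        Exec (.loop r p) s (t₁ + t₂ + 1) s₂

/-- The machine is deterministic: the number of steps and the final state are unique. -/
theorem Exec.deterministic {p : Prog} {s s₁ s₂ : State} {t₁ t₂ : ℕ}
    (h₁ : Exec p s t₁ s₁) (h₂ : Exec p s t₂ s₂) : t₁ = t₂ ∧ s₁ = s₂ := by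
  induction h₁ generalizing t₂ s₂ with
  | const | add | sub | load | store => cases h₂; exact ⟨rfl, rfl⟩
  | seq _ _ ih₁ ih₂ =>
    cases h₂ with
    | seq h h' =>
      obtain ⟨rfl, rfl⟩ := ih₁ h
      obtain ⟨rfl, rfl⟩ := ih₂ h'
      exact ⟨rfl, rfl⟩
  | ite_true hr _ ih =>
    cases h₂ with
    | ite_true _ h => obtain ⟨rfl, rfl⟩ := ih h; exact ⟨rfl, rfl⟩
    | ite_false hr' _ => exact absurd hr' hr
  | ite_false hr _ ih =>
    cases h₂ with
    | ite_true hr' _ => exact absurd hr hr'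
    | ite_false _ h => obtain ⟨rfl, rfl⟩ := ih h; exact ⟨rfl, rfl⟩
  | loop_stop hr =>
    cases h₂ with
    | loop_stop => exact ⟨rfl, rfl⟩
    | loop_step hr' => exact absurd hr hr'
  | loop_step hr _ _ ih₁ ih₂ =>
    cases h₂ with
    | loop_stop hr' => exact absurd hr' hr
    | loop_step _ h h' =>
      obtain ⟨rfl, rfl⟩ := ih₁ h
      obtain ⟨rfl, rfl⟩ := ih₂ h'
      exact ⟨rfl, rfl⟩

open Classical in
/-- `1` for a true proposition and `0` for a false one. -/
noncomputable def truthValue (P : Prop) : ℕ := if P then 1 else 0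

end RAM

/-! ## Encoding of the input and of trees -/

namespace CDC

open RAM

variable {α : Type*} [DecidableEq α] {d n : ℕ}

/-- The input for a family `S` of `d` sets whose union has been enumerated by `e`: register `0` holds
`d`, register `1` holds `n`, the first `d * n` memory cells hold the incidence matrix of the family,
row by row, and everything else is zero. -/
noncomputable def inputState (S : Fin d → Finset α)
    (e : Fin n ≃ ↥(Finset.univ.biUnion S)) : State where
  reg r := if r = 0 then d else if r = 1 then n else 0
  mem a := truthValue (∃ (i : Fin d) (j : Fin n), a = (i : ℕ) * n + (j : ℕ) ∧ (e j : α) ∈ S i)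

/-- The state `s` holds the family `S` in the same places as the input does, followed in memory by
the `d × d` adjacency matrix of `T`.  All other registers and cells are arbitrary. -/
def HoldsFamilyAndTree (s : State) (S : Fin d → Finset α)
    (e : Fin n ≃ ↥(Finset.univ.biUnion S)) (T : SimpleGraph (Fin d)) : Prop :=
  s.reg 0 = d ∧ s.reg 1 = n ∧
    (∀ (i : Fin d) (j : Fin n), s.mem ((i : ℕ) * n + (j : ℕ)) = truthValue ((e j : α) ∈ S i)) ∧
    (∀ i j : Fin d, s.mem (d * n + ((i : ℕ) * d + (j : ℕ))) = truthValue (T.Adj i j))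

end CDC

/-! Let `T` be a spanning tree and, for v in the union of the family, let T_v be the subgraph of `T`
induced on the indices i with v ∈ S i. Paths in a tree are unique, so `T` is a junction tree exactly
when every T_v is connected (`isJunctionTree_iff_forall_preconnected`). The edges of a path are
those whose deletion separates its ends, so this is also the separation condition
(`separationCondition_iff_isJunctionTree`).

Each T_v is a nonempty forest: it has at most one edge fewer than vertices, with equality iff it is
connected. Summing over v and double counting gives w(T) + n ≤ Σ |S i|, with equality iff `T` is a
junction tree (`isJunctionTree_iff_weight`). The right side does not depend on `T`, so if some
junction tree exists, every maximum spanning tree is one. The same equality reduces the separation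
condition to comparing two numbers.

A maximum spanning tree is found by Prim's algorithm, justified by an edge exchange
(`PrimInvariant.insert`). Both programs are written in a structured language with multiplication and
counted loops. Its compilation preserves the effect and takes exactly `Stmt.cost` steps
(`Stmt.exec_compile`), and `Stmt.Ensures` carries a postcondition together with a time bound. -/

/-! ### Edge counts of forests and paths in trees. -/

namespace SimpleGraph

variable {V : Type*} {G : SimpleGraph V}

/-- A forest extends to a spanning tree of the complete graph, whose edge count is known. -/
theorem IsAcyclic.card_edgeSet_add_one_le [Finite V] [Nonempty V] (h : G.IsAcyclic) :
    Nat.card G.edgeSet + 1 ≤ Nat.card V := by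
  obtain ⟨F, hGF, -, hF⟩ :=
    (connected_top (V := V)).exists_isTree_le_of_le_of_isAcyclic le_top h
  rw [← (isTree_iff_connected_and_card.1 hF).2]
  exact Nat.add_le_add_right (Nat.card_mono (Set.toFinite _) (edgeSet_mono hGF)) 1

theorem IsAcyclic.isTree_of_card_eq [Finite V] [Nonempty V] (h : G.IsAcyclic)
    (hc : Nat.card G.edgeSet + 1 = Nat.card V) : G.IsTree := by
  obtain ⟨F, hGF, -, hF⟩ :=
    (connected_top (V := V)).exists_isTree_le_of_le_of_isAcyclic le_top h
  have hcard := (isTree_iff_connected_and_card.1 hF).2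
  have : G.edgeSet = F.edgeSet := by
    refine Set.eq_of_subset_of_ncard_le (edgeSet_mono hGF) ?_ (Set.toFinite _)
    simp only [← Nat.card_coe_set_eq]
    omega
  rwa [edgeSet_injective this]

theorem IsAcyclic.card_edgeSet_add_one_eq_iff [Finite V] [Nonempty V] (h : G.IsAcyclic) :
    Nat.card G.edgeSet + 1 = Nat.card V ↔ G.Connected :=
  ⟨fun hc => (h.isTree_of_card_eq hc).connected,
    fun hc => (isTree_iff_connected_and_card.1 ⟨hc, h⟩).2⟩

/-- A path that avoids `e` would be a second path of `G` between the same ends. -/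
theorem IsTree.not_reachable_deleteEdges_of_mem_edges {u v : V} (hG : G.IsTree) {p : G.Walk u v} (hp : p.IsPath)
    {e : Sym2 V} (he : e ∈ p.edges) : ¬ (G.deleteEdges {e}).Reachable u v := by
  intro h
  obtain ⟨q, hq⟩ := h.exists_isPath
  have hle := G.deleteEdges_le {e}
  have := congrArg Walk.edges <| congrArg Subtype.val <|
    (hG.isAcyclic.subsingleton_path u v).elim ⟨p, hp⟩ ⟨q.mapLe hle, hq.mapLe hle⟩
  simp only [Walk.mapLe, Walk.edges_map, Hom.coe_ofLE, Sym2.map_id, List.map_id] at this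
  rw [this] at he
  have := q.edges_subset_edgeSet he
  simp at this

theorem Walk.support_map_induce_subset {s : Set V} {u v : s} (q : (G.induce s).Walk u v) {k : V}
    (hk : k ∈ (q.map (Embedding.induce (G := G) s).toHom).support) : k ∈ s := by
  rw [Walk.support_map, List.mem_map] at hk
  obtain ⟨k', -, rfl⟩ := hk
  exact k'.2

/-- An adjacency matrix shows each edge in both orientations. This is why the program computes twice
the weight. -/
theorem sum_sum_adj [Fintype V] [DecidableRel G.Adj] [Fintype G.edgeSet] (g : Sym2 V → ℕ) :
    ∑ i, ∑ j, (if G.Adj i j then g s(i, j) else 0) = 2 * ∑ e ∈ G.edgeFinset, g e := by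
  classical
  rw [← Fintype.sum_prod_type' (f := fun i j => if G.Adj i j then g s(i, j) else 0),
    ← Finset.sum_filter, Finset.mul_sum]
  rw [← Finset.sum_fiberwise_of_maps_to (t := G.edgeFinset) (g := fun x : V × V => s(x.1, x.2))]
  · refine Finset.sum_congr rfl fun e he => ?_
    induction e with | _ a b => ?_
    have hab : G.Adj a b := by simpa using he
    have : (Finset.univ.filter fun x : V × V => G.Adj x.1 x.2).filter
        (fun x => s(x.1, x.2) = s(a, b)) = {(a, b), (b, a)} := by
      ext ⟨x, y⟩
      simp only [Finset.mem_filter, Finset.mem_univ, true_and, Sym2.eq_iff, Finset.mem_insert,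
        Finset.mem_singleton, Prod.mk.injEq]
      constructor
      · exact fun h => h.2
      · rintro (⟨rfl, rfl⟩ | ⟨rfl, rfl⟩)
        · exact ⟨hab, .inl ⟨rfl, rfl⟩⟩
        · exact ⟨hab.symm, .inr ⟨rfl, rfl⟩⟩
    rw [this, Finset.sum_pair (by simp [hab.ne]), Sym2.eq_swap, two_mul]
  · simp

end SimpleGraph

/-! ### Junction trees, the separation condition and the weight bound. -/

namespace CDC

variable {ι α : Type*} [DecidableEq α] {S : ι → Finset α} {T : SimpleGraph ι}

@[simp] theorem mem_mid {v : α} {i j : ι} : v ∈ mid S s(i, j) ↔ v ∈ S i ∧ v ∈ S j := by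
  simp [mid]

theorem mid_mk (i j : ι) : mid S s(i, j) = S i ∩ S j := rfl

theorem mid_subset_of_mem {e : Sym2 ι} {k : ι} (hk : k ∈ e) : mid S e ⊆ S k := by
  obtain ⟨l, rfl⟩ := hk
  exact Finset.inter_subset_left

omit [DecidableEq α] in
theorem isSpanningTree_iff : IsSpanningTree S T ↔ T.IsTree := by
  simp [IsSpanningTree, intersectionGraph]

/-- Deleting an edge of the path from i to j separates i from j, so the separation condition applies
to it. Conversely, a path between different components of `T` without `e` must use `e`. The vertex
condition follows from the edge condition, since a vertex of a path is its endpoint or lies on one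
of its edges. -/
theorem separationCondition_iff_isJunctionTree (hT : IsSpanningTree S T) :
    SeparationCondition S T ↔ IsJunctionTree S T := by
  classical
  have hT' := isSpanningTree_iff.1 hT
  constructor
  · intro h
    have key : ∀ (i j : ι) (p : T.Walk i j), p.IsPath → ∀ e ∈ p.edges, S i ∩ S j ⊆ mid S e := by
      intro i j p hp e he v hv
      rw [Finset.mem_inter] at hv
      refine h e (p.edges_subset_edgeSet he)
        ((T.deleteEdges {e}).connectedComponentMk i) ((T.deleteEdges {e}).connectedComponentMk j)
        ?_ ⟨?_, ?_⟩
      · rw [Ne, SimpleGraph.ConnectedComponent.eq]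
        exact hT'.not_reachable_deleteEdges_of_mem_edges hp he
      · exact Set.mem_biUnion (x := i) rfl hv.1
      · exact Set.mem_biUnion (x := j) rfl hv.2
    refine ⟨hT, fun i j p hp => ⟨fun k hk => ?_, key i j p hp⟩⟩
    rcases SimpleGraph.Walk.mem_support_iff_exists_mem_edges.1 hk with rfl | ⟨e, he, hke⟩
    · exact Finset.inter_subset_right
    · exact (key i j p hp e he).trans (mid_subset_of_mem hke)
  · rintro ⟨-, h⟩ e he C₁ C₂ hC v ⟨hv₁, hv₂⟩
    simp only [Set.mem_iUnion] at hv₁ hv₂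
    obtain ⟨k, hk, hvk⟩ := hv₁
    obtain ⟨l, hl, hvl⟩ := hv₂
    obtain ⟨p, hp⟩ := hT'.connected.exists_isPath k l
    have hep : e ∈ p.edges := by
      by_contra hep
      apply hC
      rw [← hk, ← hl, SimpleGraph.ConnectedComponent.eq]
      exact ⟨p.toDeleteEdges {e} fun e' he' h' => hep (by rwa [← Set.mem_singleton_iff.1 h'])⟩
    exact (h k l p hp).2 e hep (Finset.mem_inter.2 ⟨hvk, hvl⟩)

/-- A path inside the induced subgraph is, by uniqueness, the path of `T`; hence the latter never
leaves the sets containing v. -/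
theorem isJunctionTree_iff_forall_preconnected (hT : IsSpanningTree S T) :
    IsJunctionTree S T ↔ ∀ v, (T.induce {i | v ∈ S i}).Preconnected := by
  have hT' := isSpanningTree_iff.1 hT
  constructor
  · rintro ⟨-, h⟩ v ⟨i, hi⟩ ⟨j, hj⟩
    obtain ⟨p, hp⟩ := hT'.connected.exists_isPath i j
    exact ⟨p.induce _ fun k hk => (h i j p hp).1 k hk (Finset.mem_inter.2 ⟨hi, hj⟩)⟩
  · intro h
    have key : ∀ (i j : ι) (p : T.Walk i j), p.IsPath → ∀ k ∈ p.support, S i ∩ S j ⊆ S k := by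
      intro i j p hp k hk v hv
      rw [Finset.mem_inter] at hv
      obtain ⟨q, hq⟩ := (h v ⟨i, hv.1⟩ ⟨j, hv.2⟩).exists_isPath
      let f := SimpleGraph.Embedding.induce (G := T) {i | v ∈ S i}
      have := congrArg SimpleGraph.Walk.support <| congrArg Subtype.val <|
        (hT'.isAcyclic.subsingleton_path i j).elim ⟨p, hp⟩
          ⟨q.map f.toHom, hq.map f.injective⟩
      have hk' : k ∈ (q.map f.toHom).support := this ▸ hk
      exact q.support_map_induce_subset hk'
    refine ⟨hT, fun i j p hp => ⟨key i j p hp, fun e he => ?_⟩⟩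
    induction e with | _ a b => ?_
    exact Finset.subset_inter (key i j p hp a (p.fst_mem_support_of_mem_edges he))
      (key i j p hp b (p.snd_mem_support_of_mem_edges he))

section Fintype

variable [Fintype ι]

open Classical in
theorem card_filter_mem_mid (S : ι → Finset α) (T : SimpleGraph ι) (v : α) :
    (T.edgeFinset.filter fun e => v ∈ mid S e).card
      = Nat.card (T.induce {i | v ∈ S i}).edgeSet := by
  rw [Nat.card_eq_fintype_card, SimpleGraph.card_edgeSet,
    ← Finset.card_map (Function.Embedding.subtype (· ∈ {i | v ∈ S i})).sym2Map,
    SimpleGraph.map_edgeFinset_induce]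
  congr 1
  ext e
  induction e with | _ a b => simp

-- Double counting of the pairs (e, v) with v in the middle set of e.
open Classical in
theorem weight_eq_sum (S : ι → Finset α) (T : SimpleGraph ι) :
    weight S T = ∑ v ∈ Finset.univ.biUnion S, Nat.card (T.induce {i | v ∈ S i}).edgeSet := by
  simp_rw [← card_filter_mem_mid]
  refine Eq.trans ?_
    (Finset.sum_card_bipartiteAbove_eq_sum_card_bipartiteBelow (fun e v => v ∈ mid S e))
  refine Finset.sum_congr rfl fun e _ => congrArg _ ?_
  ext v
  induction e with | _ a b => ?_
  simp only [Finset.bipartiteAbove, Finset.mem_filter, Finset.mem_biUnion, Finset.mem_univ,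
    true_and, mem_mid]
  exact ⟨fun h => ⟨⟨a, h.1⟩, h⟩, fun h => h.2⟩

theorem sum_card_eq_sum (S : ι → Finset α) :
    ∑ i, (S i).card = ∑ v ∈ Finset.univ.biUnion S, Nat.card {i | v ∈ S i} := by
  classical
  have : ∀ v, Nat.card {i | v ∈ S i} = (Finset.univ.filter fun i => v ∈ S i).card := by
    intro v
    rw [Nat.card_eq_fintype_card, ← Set.toFinset_card]
    congr 1
    ext; simp
  simp_rw [this]
  refine Eq.trans ?_
    (Finset.sum_card_bipartiteAbove_eq_sum_card_bipartiteBelow (fun i v => v ∈ S i))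
  refine Finset.sum_congr rfl fun i _ => congrArg _ ?_
  ext v
  simp only [Finset.bipartiteAbove, Finset.mem_filter, Finset.mem_biUnion, Finset.mem_univ,
    true_and]
  exact ⟨fun h => ⟨⟨i, h⟩, h⟩, fun h => h.2⟩

theorem weight_add_card (S : ι → Finset α) (T : SimpleGraph ι) :
    weight S T + (Finset.univ.biUnion S).card
      = ∑ v ∈ Finset.univ.biUnion S, (Nat.card (T.induce {i | v ∈ S i}).edgeSet + 1) := by
  rw [weight_eq_sum, Finset.sum_add_distrib, Finset.card_eq_sum_ones]

theorem nonempty_of_mem_biUnion {v : α} (hv : v ∈ Finset.univ.biUnion S) :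
    Nonempty {i | v ∈ S i} := by
  obtain ⟨i, -, hi⟩ := Finset.mem_biUnion.1 hv
  exact ⟨⟨i, hi⟩⟩

/-- The forest bound, applied to each induced subgraph and summed over v. -/
theorem weight_add_card_le (hT : IsSpanningTree S T) :
    weight S T + (Finset.univ.biUnion S).card ≤ ∑ i, (S i).card := by
  rw [weight_add_card, sum_card_eq_sum]
  refine Finset.sum_le_sum fun v hv => ?_
  have := nonempty_of_mem_biUnion hv
  exact ((isSpanningTree_iff.1 hT).isAcyclic.induce _).card_edgeSet_add_one_le

/-- Equality of the sums forces equality for each v, which means connectedness. An element outside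
the union gives an empty subgraph, which is trivially preconnected. -/
theorem isJunctionTree_iff_weight (hT : IsSpanningTree S T) :
    IsJunctionTree S T ↔
      weight S T + (Finset.univ.biUnion S).card = ∑ i, (S i).card := by
  have hac := fun v => (isSpanningTree_iff.1 hT).isAcyclic.induce {i | v ∈ S i}
  rw [isJunctionTree_iff_forall_preconnected hT, weight_add_card, sum_card_eq_sum,
    Finset.sum_eq_sum_iff_of_le]
  · constructor
    · intro h v hv
      have := nonempty_of_mem_biUnion hv
      exact (hac v).card_edgeSet_add_one_eq_iff.2 ⟨h v⟩
    · intro h v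
      by_cases hv : v ∈ Finset.univ.biUnion S
      · have := nonempty_of_mem_biUnion hv
        exact ((hac v).card_edgeSet_add_one_eq_iff.1 (h v hv)).preconnected
      · rintro ⟨i, hi⟩
        exact absurd (Finset.mem_biUnion.2 ⟨i, Finset.mem_univ i, hi⟩) hv
  · intro v hv
    have := nonempty_of_mem_biUnion hv
    exact (hac v).card_edgeSet_add_one_le

theorem separationCondition_iff_weight (hT : IsSpanningTree S T) :
    SeparationCondition S T ↔
      weight S T + (Finset.univ.biUnion S).card = ∑ i, (S i).card :=
  (separationCondition_iff_isJunctionTree hT).trans (isJunctionTree_iff_weight hT)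

/-- A junction tree attains the upper bound for the weight, so a maximum spanning tree attains it
too. -/
theorem IsMaxSpanningTree.admitsJunctionTree_iff (hT : IsMaxSpanningTree S T) :
    AdmitsJunctionTree S ↔ SeparationCondition S T := by
  rw [separationCondition_iff_isJunctionTree hT.1]
  refine ⟨?_, fun h => ⟨T, h⟩⟩
  rintro ⟨T', hT'⟩
  have h := (isJunctionTree_iff_weight hT'.1).1 hT'
  have := hT.2 T' hT'.1
  have := weight_add_card_le hT.1
  exact (isJunctionTree_iff_weight hT.1).2 (by omega)

theorem exists_isMaxSpanningTree [Nonempty ι] (S : ι → Finset α) :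
    ∃ T : SimpleGraph ι, IsMaxSpanningTree S T := by
  have hne : {T : SimpleGraph ι | IsSpanningTree S T}.Nonempty := by
    obtain ⟨T, -, hT⟩ := (SimpleGraph.connected_top (V := ι)).exists_isTree_le
    exact ⟨T, isSpanningTree_iff.2 hT⟩
  obtain ⟨T, hT, h⟩ := Set.exists_max_image _ (weight S) (Set.toFinite _) hne
  exact ⟨T, hT, h⟩

end Fintype

end CDC

/-! ### Edge exchange and the correctness of Prim's algorithm. -/

namespace SimpleGraph

variable {V : Type*} {G : SimpleGraph V}

theorem Walk.exists_mem_edges_of_mem_of_notMem {U : Set V} :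
    ∀ {u v : V} (p : G.Walk u v), u ∈ U → v ∉ U →
      ∃ x y, s(x, y) ∈ p.edges ∧ x ∈ U ∧ y ∉ U
  | _, _, .nil, hu, hv => absurd hu hv
  | u, _, .cons (v := w) h p, hu, hv => by
    by_cases hw : w ∈ U
    · obtain ⟨x, y, hxy, hx, hy⟩ := p.exists_mem_edges_of_mem_of_notMem hw hv
      exact ⟨x, y, List.mem_cons_of_mem _ hxy, hx, hy⟩
    · exact ⟨u, w, List.mem_cons_self, hu, hw⟩

open Classical in
theorem edgeFinset_deleteEdges_sup_edge [Fintype V] {f : Sym2 V} {a b : V} (hab : a ≠ b) :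
    (G.deleteEdges {f} ⊔ edge a b).edgeFinset = insert s(a, b) (G.edgeFinset.erase f) := by
  ext e
  induction e with | _ x y => ?_
  simp only [mem_edgeFinset, mem_edgeSet, sup_adj, deleteEdges_adj, edge_adj, Finset.mem_insert,
    Finset.mem_erase, Set.mem_singleton_iff, Sym2.eq_iff]
  have := G.ne_of_adj (a := x) (b := y)
  grind

/-- Exchanging an edge on the tree path between `a` and `b` for the edge `ab`. -/
theorem IsTree.deleteEdges_sup_edge [Finite V] (hG : G.IsTree) {a b : V} {p : G.Walk a b}
    (hp : p.IsPath) {f : Sym2 V} (hf : f ∈ p.edges) (hab : ¬ G.Adj a b) (hne : a ≠ b) :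
    (G.deleteEdges {f} ⊔ edge a b).IsTree := by
  classical
  have := Fintype.ofFinite V
  have := hG.connected.nonempty
  -- Without `f` the vertices `a` and `b` are disconnected, so the new edge closes no cycle. The
  -- number of edges is unchanged, and a forest with that many edges is a tree.
  have hacyc : (G.deleteEdges {f} ⊔ edge a b).IsAcyclic :=
    (hG.isAcyclic.anti (G.deleteEdges_le {f})).sup_edge_of_not_reachable
      (hG.not_reachable_deleteEdges_of_mem_edges hp hf)
  refine hacyc.isTree_of_card_eq ?_
  have hcard := hG.card_edgeFinset
  have hfG : f ∈ G.edgeFinset := by simpa using p.edges_subset_edgeSet hf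
  rw [Nat.card_eq_fintype_card, card_edgeSet, edgeFinset_deleteEdges_sup_edge hne,
    Finset.card_insert_of_notMem (by simp [hab]), Finset.card_erase_add_one hfG,
    Nat.card_eq_fintype_card]
  have := Finset.card_pos.2 ⟨f, hfG⟩
  convert hcard

end SimpleGraph

namespace CDC

open SimpleGraph

variable {ι α : Type*} [DecidableEq α] {S : ι → Finset α} {T F : SimpleGraph ι} [Fintype ι]

theorem weight_eq_sum_edgeFinset (S : ι → Finset α) (T : SimpleGraph ι) [Fintype T.edgeSet] :
    weight S T = ∑ e ∈ T.edgeFinset, (mid S e).card := by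
  unfold weight
  congr!

theorem weight_deleteEdges_sup_edge {f : Sym2 ι} {a b : ι} (hf : f ∈ T.edgeSet)
    (hab : ¬ T.Adj a b) (hne : a ≠ b) :
    weight S (T.deleteEdges {f} ⊔ edge a b) + (mid S f).card
      = weight S T + (mid S s(a, b)).card := by
  classical
  have hf' : f ∈ T.edgeFinset := by simpa using hf
  have h₁ : ∑ e ∈ (T.deleteEdges {f} ⊔ edge a b).edgeFinset, (mid S e).card
      = (mid S s(a, b)).card + ∑ e ∈ T.edgeFinset.erase f, (mid S e).card := by
    rw [edgeFinset_deleteEdges_sup_edge hne]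
    exact Finset.sum_insert (by simp [hab])
  have h₂ := Finset.sum_erase_add T.edgeFinset (fun e => (mid S e).card) hf'
  rw [weight_eq_sum_edgeFinset, weight_eq_sum_edgeFinset]
  omega

/-- The invariant of Prim's algorithm: `F` is a tree with vertex set `U` that can be extended to a
maximum spanning tree. -/
structure PrimInvariant (S : ι → Finset α) (U : Set ι) (F : SimpleGraph ι) : Prop where
  mem_of_adj : ∀ i j, F.Adj i j → i ∈ U
  reachable : ∀ i ∈ U, ∀ j ∈ U, F.Reachable i j
  exists_le : ∃ T, IsMaxSpanningTree S T ∧ F ≤ T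

theorem PrimInvariant.singleton (S : ι → Finset α) (r : ι) : PrimInvariant S {r} ⊥ where
  mem_of_adj := by simp
  reachable := by
    rintro i rfl j rfl
    exact .rfl
  exists_le := by
    have : Nonempty ι := ⟨r⟩
    obtain ⟨T, hT⟩ := exists_isMaxSpanningTree S
    exact ⟨T, hT, bot_le⟩

/-- Trees are minimal among connected graphs, so a connected subgraph of `T` is `T` itself. -/
theorem PrimInvariant.isMaxSpanningTree [Nonempty ι] (h : PrimInvariant S Set.univ F) :
    IsMaxSpanningTree S F := by
  obtain ⟨T, hT, hFT⟩ := h.exists_le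
  have hF : F.Connected := ⟨fun i j => h.reachable i trivial j trivial⟩
  have := (isTree_iff_minimal_connected.1 (isSpanningTree_iff.1 hT.1)).le_of_le hF hFT
  rwa [le_antisymm hFT this]

/-- The cut property: a heaviest edge leaving `U` can be added. If the maximum spanning tree `T`
lacks it, the path of `T` from `a` to `b` leaves `U` along some edge, which is no heavier and can be
exchanged for `ab`. -/
theorem PrimInvariant.insert {U : Set ι} (h : PrimInvariant S U F) {a b : ι} (ha : a ∈ U)
    (hb : b ∉ U) (hmax : ∀ x ∈ U, ∀ y ∉ U, (S x ∩ S y).card ≤ (S a ∩ S b).card) :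
    PrimInvariant S (insert b U) (F ⊔ edge a b) where
  mem_of_adj i j hij := by
    rw [sup_adj, edge_adj] at hij
    rcases hij with hij | ⟨⟨rfl, rfl⟩ | ⟨rfl, rfl⟩, -⟩
    · exact .inr (h.mem_of_adj i j hij)
    · exact .inr ha
    · exact .inl rfl
  reachable := by
    have hab : (F ⊔ edge a b).Reachable a b := by
      refine Adj.reachable ?_
      rw [sup_adj, edge_adj]
      exact .inr ⟨.inl ⟨rfl, rfl⟩, fun hab => hb (hab ▸ ha)⟩
    have key : ∀ i ∈ Insert.insert b U, (F ⊔ edge a b).Reachable a i := by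
      rintro i (rfl | hi)
      · exact hab
      · exact (h.reachable a ha i hi).mono le_sup_left
    exact fun i hi j hj => (key i hi).symm.trans (key j hj)
  exists_le := by
    obtain ⟨T, hT, hFT⟩ := h.exists_le
    have hne : a ≠ b := fun hab => hb (hab ▸ ha)
    by_cases hab : T.Adj a b
    · exact ⟨T, hT, sup_le hFT ((edge_le_iff T).2 (.inr hab))⟩
    have hT' := isSpanningTree_iff.1 hT.1
    obtain ⟨p, hp⟩ := hT'.connected.exists_isPath a b
    obtain ⟨x, y, hxy, hx, hy⟩ := p.exists_mem_edges_of_mem_of_notMem ha hb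
    have htree := hT'.deleteEdges_sup_edge hp hxy hab hne
    refine ⟨T.deleteEdges {s(x, y)} ⊔ edge a b, ⟨isSpanningTree_iff.2 htree, fun T' hT'' => ?_⟩,
      sup_le_sup_right ?_ _⟩
    · have hw := weight_deleteEdges_sup_edge (S := S) (p.edges_subset_edgeSet hxy) hab hne
      have := hmax x hx y hy
      have := hT.2 T' hT''
      simp only [mid_mk] at hw
      omega
    -- The removed edge has an end outside `U`, where `F` has no edges, so `F` survives the
    -- exchange.
    · intro i j hij
      rw [deleteEdges_adj]
      refine ⟨hFT hij, fun hs => ?_⟩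
      rcases Sym2.eq_iff.1 (Set.mem_singleton_iff.1 hs) with ⟨rfl, rfl⟩ | ⟨rfl, rfl⟩
      · exact hy (h.mem_of_adj _ _ hij.symm)
      · exact hy (h.mem_of_adj _ _ hij)

end CDC

namespace RAM

/-! ### A structured language and its compilation -/

/-- Arithmetic expressions over the registers and the memory. -/
inductive Expr : Type
  | var (x : ℕ) : Expr
  | const (k : ℕ) : Expr
  | add (e f : Expr) : Expr
  | sub (e f : Expr) : Expr
  | mul (e f : Expr) : Expr
  | load (e : Expr) : Expr

/-- Statements; `loop x e p` runs `p` for `x = e - 1, …, 0`. -/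
inductive Stmt : Type
  | skip : Stmt
  | set (x : ℕ) (e : Expr) : Stmt
  | store (a e : Expr) : Stmt
  | seq (p q : Stmt) : Stmt
  | ite (e : Expr) (p q : Stmt) : Stmt
  | loop (x : ℕ) (e : Expr) (p : Stmt) : Stmt

theorem Exec.of_eq {p : Prog} {s s' : State} {t t' : ℕ} (h : Exec p s t s') (ht : t = t') :
    Exec p s t' s' := ht ▸ h

namespace State

@[simp] theorem setReg_reg (s : State) (x v r : ℕ) :
    (s.setReg x v).reg r = if r = x then v else s.reg r := by
  simp [setReg, Function.update_apply]

@[simp] theorem setReg_mem (s : State) (x v : ℕ) : (s.setReg x v).mem = s.mem := rfl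

@[simp] theorem setMem_reg (s : State) (a v : ℕ) : (s.setMem a v).reg = s.reg := rfl

theorem setMem_mem (s : State) (a v b : ℕ) :
    (s.setMem a v).mem b = if b = a then v else s.mem b := by
  simp [setMem, Function.update_apply]

/-- The states have the same memory and the same registers below `K`. -/
structure Agree (K : ℕ) (s s' : State) : Prop where
  mem : s'.mem = s.mem
  reg : ∀ r < K, s'.reg r = s.reg r

namespace Agree

variable {K : ℕ} {s s' s'' : State}

theorem refl (K : ℕ) (s : State) : Agree K s s := ⟨rfl, fun _ _ => rfl⟩

theorem trans (h : Agree K s s') (h' : Agree K s' s'') : Agree K s s'' :=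
  ⟨h'.mem.trans h.mem, fun r hr => (h'.reg r hr).trans (h.reg r hr)⟩

theorem mono {L : ℕ} (hKL : K ≤ L) (h : Agree L s s') : Agree K s s' :=
  ⟨h.mem, fun r hr => h.reg r (hr.trans_le hKL)⟩

theorem setReg_right (h : Agree K s s') {x : ℕ} (hx : K ≤ x) (v : ℕ) :
    Agree K s (s'.setReg x v) :=
  ⟨h.mem, fun r hr => by rw [setReg_reg, if_neg (by omega), h.reg r hr]⟩

theorem setReg (h : Agree K s s') (x v : ℕ) : Agree K (s.setReg x v) (s'.setReg x v) :=
  ⟨h.mem, fun r hr => by rw [setReg_reg, setReg_reg, h.reg r hr]⟩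

theorem setMem (h : Agree K s s') (a v : ℕ) : Agree K (s.setMem a v) (s'.setMem a v) :=
  ⟨by simp [State.setMem, h.mem], h.reg⟩

end Agree

end State

open State

/-! ### Expressions: compilation and exact running time. -/

namespace Expr

/-- The value of an expression. -/
def eval : Expr → State → ℕ
  | var x, s => s.reg x
  | const k, _ => k
  | add e f, s => e.eval s + f.eval s
  | sub e f, s => e.eval s - f.eval s
  | mul e f, s => e.eval s * f.eval s
  | load e, s => s.mem (e.eval s)

/-- The number of steps taken by the compiled expression. -/
def cost : Expr → State → ℕ
  | var _, _ => 2
  | const _, _ => 1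
  | add e f, s => e.cost s + f.cost s + 1
  | sub e f, s => e.cost s + f.cost s + 1
  | mul e f, s => e.cost s + f.cost s + 3 * f.eval s + 4
  | load e, s => e.cost s + 1

/-- All registers in the expression are below `K`. -/
def Below (K : ℕ) : Expr → Prop
  | var x => x < K
  | const _ => True
  | add e f => e.Below K ∧ f.Below K
  | sub e f => e.Below K ∧ f.Below K
  | mul e f => e.Below K ∧ f.Below K
  | load e => e.Below K

/-- Multiplication of register `K` by register `K + 1`, by repeated addition. -/
def mulProg (K : ℕ) : Prog :=
  .seq (.const (K + 2) 0) (.seq (.const (K + 3) 1)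
    (.seq (.loop (K + 1) (.seq (.sub (K + 1) (K + 1) (K + 3)) (.add (K + 2) (K + 2) K)))
      -- The loop leaves register `K + 1` at zero, so this addition just copies the product.
      (.add K (K + 1) (K + 2))))

/-- The program that puts the value of the expression into register `K`, using only registers
from `K` on. -/
def compile : Expr → ℕ → Prog
  | var x, K => .seq (.const K 0) (.add K K x)
  | const k, K => .const K k
  | add e f, K => .seq (e.compile K) (.seq (f.compile (K + 1)) (.add K K (K + 1)))
  | sub e f, K => .seq (e.compile K) (.seq (f.compile (K + 1)) (.sub K K (K + 1)))
  | mul e f, K => .seq (e.compile K) (.seq (f.compile (K + 1)) (mulProg K))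
  | load e, K => .seq (e.compile K) (.load K K)

variable {K : ℕ} {e : Expr} {s s' : State}

theorem Below.mono {L : ℕ} (hKL : K ≤ L) (h : e.Below K) : e.Below L := by
  induction e with
  | var x => exact lt_of_lt_of_le h hKL
  | const k => trivial
  | add e f ihe ihf | sub e f ihe ihf | mul e f ihe ihf => exact ⟨ihe h.1, ihf h.2⟩
  | load e ih => exact ih h

theorem eval_congr (h : e.Below K) (hs : Agree K s s') : e.eval s' = e.eval s := by
  induction e with
  | var x => exact hs.reg x h
  | const k => rfl
  | add e f ihe ihf | sub e f ihe ihf | mul e f ihe ihf => simp only [eval, ihe h.1, ihf h.2]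
  | load e ih => simp only [eval, ih h, hs.mem]

theorem cost_congr (h : e.Below K) (hs : Agree K s s') : e.cost s' = e.cost s := by
  induction e with
  | var x | const k => rfl
  | add e f ihe ihf | sub e f ihe ihf => simp only [cost, ihe h.1, ihf h.2]
  | mul e f ihe ihf => simp only [cost, ihe h.1, ihf h.2, eval_congr h.2 hs]
  | load e ih => simp only [cost, ih h]

/-- Each pass costs three steps: test, subtraction, addition. The failing test at the end costs one
more. -/
theorem exec_mulLoop (K v : ℕ) (s : State) (hv : s.reg (K + 1) = v) (h₁ : s.reg (K + 3) = 1) :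
    ∃ s', Exec (.loop (K + 1) (.seq (.sub (K + 1) (K + 1) (K + 3)) (.add (K + 2) (K + 2) K))) s
      (3 * v + 1) s' ∧ Agree (K + 1) s s' ∧ s'.reg (K + 1) = 0 ∧
      s'.reg (K + 2) = s.reg (K + 2) + s.reg K * v := by
  induction v generalizing s with
  | zero => exact ⟨s, Exec.loop_stop hv, .refl _ _, hv, by simp⟩
  | succ v ih =>
    let s₁ := s.setReg (K + 1) (s.reg (K + 1) - s.reg (K + 3))
    let s₂ := s₁.setReg (K + 2) (s₁.reg (K + 2) + s₁.reg K)
    have hs₂ : Agree (K + 1) s s₂ := ((Agree.refl _ s).setReg_right le_rfl _).setReg_right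
      (Nat.le_succ _) _
    obtain ⟨s', hs', ha, hz, hr⟩ := ih s₂ (by simp [s₂, s₁, hv, h₁]) (by simp [s₂, s₁, h₁])
    refine ⟨s', ?_, hs₂.trans ha, hz, ?_⟩
    · exact (Exec.loop_step (by omega) (.seq (.sub (K + 1) (K + 1) (K + 3) s)
        (.add (K + 2) (K + 2) K s₁)) hs').of_eq (by omega)
    · rw [hr]
      simp only [s₂, s₁, setReg_reg]
      simp
      ring

theorem exec_mulProg (K : ℕ) (s : State) :
    ∃ s', Exec (mulProg K) s (3 * s.reg (K + 1) + 4) s' ∧ Agree K s s' ∧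
      s'.reg K = s.reg K * s.reg (K + 1) := by
  let s₁ := s.setReg (K + 2) 0
  let s₂ := s₁.setReg (K + 3) 1
  obtain ⟨s₃, h₃, ha, hz, hr⟩ := exec_mulLoop K (s.reg (K + 1)) s₂ (by simp [s₂, s₁])
    (by simp [s₂])
  refine ⟨s₃.setReg K (s₃.reg (K + 1) + s₃.reg (K + 2)), ?_, ?_, ?_⟩
  · exact (Exec.seq (.const (K + 2) 0 s) (.seq (.const (K + 3) 1 s₁)
      (.seq h₃ (.add K (K + 1) (K + 2) s₃)))).of_eq (by omega)
  · exact ((((Agree.refl K s).setReg_right (by omega) 0).setReg_right (by omega) 1).trans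
      (ha.mono (Nat.le_succ K))).setReg_right le_rfl _
  · simp [hz, hr, s₂, s₁]

theorem exec_compile (e : Expr) (K : ℕ) (s : State) (h : e.Below K) :
    ∃ s', Exec (e.compile K) s (e.cost s) s' ∧ Agree K s s' ∧ s'.reg K = e.eval s := by
  -- Common to the binary operations: scratch registers form a stack. Evaluating `e` changes nothing
  -- that `f` reads, and evaluating `f` from `K + 1` on leaves the value in register `K` intact.
  have pair : ∀ {e f : Expr} {K : ℕ} {s : State}, e.Below K → f.Below K →
      (∃ s', Exec (e.compile K) s (e.cost s) s' ∧ Agree K s s' ∧ s'.reg K = e.eval s) →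
      (∀ s, f.Below (K + 1) → ∃ s', Exec (f.compile (K + 1)) s (f.cost s) s' ∧
        Agree (K + 1) s s' ∧ s'.reg (K + 1) = f.eval s) →
      ∃ s₁ s₂, Exec (e.compile K) s (e.cost s) s₁ ∧ Exec (f.compile (K + 1)) s₁ (f.cost s) s₂ ∧
        Agree K s s₂ ∧ s₂.reg K = e.eval s ∧ s₂.reg (K + 1) = f.eval s := by
    rintro e f K s he hf ⟨s₁, hs₁, ha₁, hr₁⟩ ihf
    obtain ⟨s₂, hs₂, ha₂, hr₂⟩ := ihf s₁ (hf.mono (Nat.le_succ K))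
    refine ⟨s₁, s₂, hs₁, by rwa [← cost_congr hf ha₁], ha₁.trans (ha₂.mono (Nat.le_succ K)), ?_, ?_⟩
    · rw [ha₂.reg K (Nat.lt_succ_self K), hr₁]
    · rw [hr₂, eval_congr hf ha₁]
  induction e generalizing K s with
  | var x =>
    have hx : x ≠ K := Nat.ne_of_lt h
    refine ⟨_, .seq (.const K 0 s) (.add K K x _), ?_, by simp [eval, hx]⟩
    exact ((Agree.refl K s).setReg_right le_rfl _).setReg_right le_rfl _
  | const k => exact ⟨_, .const K k s, (Agree.refl K s).setReg_right le_rfl _, by simp [eval]⟩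
  | add e f ihe ihf =>
    obtain ⟨s₁, s₂, hs₁, hs₂, ha, he, hf⟩ := pair h.1 h.2 (ihe K s h.1) (ihf (K + 1))
    refine ⟨_, (Exec.seq hs₁ (.seq hs₂ (.add K K (K + 1) s₂))).of_eq (by simp only [cost]; omega),
      ha.setReg_right le_rfl _, ?_⟩
    simp [eval, he, hf]
  | sub e f ihe ihf =>
    obtain ⟨s₁, s₂, hs₁, hs₂, ha, he, hf⟩ := pair h.1 h.2 (ihe K s h.1) (ihf (K + 1))
    refine ⟨_, (Exec.seq hs₁ (.seq hs₂ (.sub K K (K + 1) s₂))).of_eq (by simp only [cost]; omega),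
      ha.setReg_right le_rfl _, ?_⟩
    simp [eval, he, hf]
  | mul e f ihe ihf =>
    obtain ⟨s₁, s₂, hs₁, hs₂, ha, he, hf⟩ := pair h.1 h.2 (ihe K s h.1) (ihf (K + 1))
    obtain ⟨s₃, hs₃, ha₃, hr₃⟩ := exec_mulProg K s₂
    exact ⟨s₃, (Exec.seq hs₁ (.seq hs₂ hs₃)).of_eq (by simp only [cost, hf]; omega),
      ha.trans ha₃, by rw [hr₃, he, hf, eval]⟩
  | load e ih =>
    obtain ⟨s₁, hs₁, ha, he⟩ := ih K s h
    refine ⟨_, .seq hs₁ (.load K K s₁), ha.setReg_right le_rfl _, ?_⟩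
    simp [eval, he, ha.mem]

end Expr

/-! ### Statements: effect, cost and compilation. -/

namespace Stmt

/-- Iterate `f` with register `x` running down from `k - 1` to `0`. -/
def runLoop (f : State → State) (x : ℕ) : ℕ → State → State
  | 0, s => s
  | k + 1, s => runLoop f x k (f (s.setReg x k))

/-- The number of steps taken by a compiled loop, if the body takes `c` steps. -/
def costLoop (f : State → State) (c : State → ℕ) (x : ℕ) : ℕ → State → ℕ
  | 0, _ => 1
  | k + 1, s => costLoop f c x k (f (s.setReg x k)) + c (s.setReg x k) + 5

/-- The effect of a statement. -/
def run : Stmt → State → State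
  | skip, s => s
  | set x e, s => s.setReg x (e.eval s)
  | store a e, s => s.setMem (a.eval s) (e.eval s)
  | seq p q, s => q.run (p.run s)
  | ite e p q, s => if e.eval s ≠ 0 then p.run s else q.run s
  | loop x e p, s => runLoop p.run x (e.eval s) s

/-- The number of steps taken by the compiled statement. -/
def cost : Stmt → State → ℕ
  | skip, _ => 1
  | set _ e, s => e.cost s + 2
  | store a e, s => a.cost s + e.cost s + 1
  | seq p q, s => p.cost s + q.cost (p.run s)
  | ite e p q, s => e.cost s + (if e.eval s ≠ 0 then p.cost s else q.cost s) + 1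
  | loop x e p, s => e.cost s + costLoop p.run p.cost x (e.eval s) s

/-- All registers in the statement are below `K`. -/
def Below (K : ℕ) : Stmt → Prop
  | skip => True
  | set x e => x < K ∧ e.Below K
  | store a e => a.Below K ∧ e.Below K
  | seq p q => p.Below K ∧ q.Below K
  | ite e p q => e.Below K ∧ p.Below K ∧ q.Below K
  | loop x e p => x < K ∧ e.Below K ∧ p.Below K

/-- The machine program for a statement; registers from `K` on are used for intermediate results. -/
def compile : Stmt → ℕ → Prog
  | skip, K => .const K 0
  | set x e, K => .seq (e.compile K) (.seq (.const (K + 1) 0) (.add x K (K + 1)))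
  | store a e, K => .seq (a.compile K) (.seq (e.compile (K + 1)) (.store K (K + 1)))
  | seq p q, K => .seq (p.compile K) (q.compile K)
  | ite e p q, K => .seq (e.compile K) (.ite K (p.compile K) (q.compile K))
  | loop x e p, K => .seq (e.compile K) (.loop K (.seq (.const x 1) (.seq (.sub K K x)
      (.seq (.const x 0) (.seq (.add x x K) (p.compile (K + 1)))))))

variable {K : ℕ} {p : Stmt} {s s' : State}

/-- The counter sits in register `L`, out of reach of the body, so the body may overwrite `x`. The
overhead of a round is five steps: the test and the four instructions that decrement the counter,
with `x` briefly holding 1, and copy it to `x`. -/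
theorem exec_loop {x L : ℕ} (hx : x < K) (hL : K ≤ L)
    (ih : ∀ s s₁, Agree K s s₁ → ∃ s', Exec (p.compile (L + 1)) s₁ (p.cost s) s' ∧
      Agree K (p.run s) s' ∧ ∀ r, K ≤ r → r < L + 1 → s'.reg r = s₁.reg r)
    (k : ℕ) (s s₁ : State) (hs : Agree K s s₁) (hk : s₁.reg L = k) :
    ∃ s', Exec (.loop L (.seq (.const x 1) (.seq (.sub L L x)
        (.seq (.const x 0) (.seq (.add x x L) (p.compile (L + 1))))))) s₁
        (costLoop p.run p.cost x k s) s' ∧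
      Agree K (runLoop p.run x k s) s' ∧ ∀ r, K ≤ r → r < L → s'.reg r = s₁.reg r := by
  induction k generalizing s s₁ with
  | zero => exact ⟨s₁, Exec.loop_stop hk, hs, fun _ _ _ => rfl⟩
  | succ k ihk =>
    have hxL : L ≠ x := by omega
    let t₁ := s₁.setReg x 1
    let t₂ := t₁.setReg L (t₁.reg L - t₁.reg x)
    let t₃ := t₂.setReg x 0
    let t₄ := t₃.setReg x (t₃.reg x + t₃.reg L)
    have ht₄ : t₄.reg L = k := by simp [t₄, t₃, t₂, t₁, hxL, hk]
    have hframe : ∀ r, r ≠ x → r ≠ L → t₄.reg r = s₁.reg r := by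
      intro r hrx hrL
      simp [t₄, t₃, t₂, t₁, hrx, hrL]
    have hagree : Agree K (s.setReg x k) t₄ := by
      refine ⟨hs.mem, fun r hr => ?_⟩
      by_cases hrx : r = x
      · simp [t₄, t₃, t₂, t₁, hxL, hk, hrx]
      · rw [hframe r hrx (by omega), hs.reg r hr, setReg_reg, if_neg hrx]
    obtain ⟨s₂, hs₂, ha₂, hr₂⟩ := ih _ _ hagree
    obtain ⟨s₃, hs₃, ha₃, hr₃⟩ := ihk _ s₂ ha₂ ((hr₂ L hL (Nat.lt_succ_self L)).trans ht₄)
    refine ⟨s₃, ?_, ha₃, fun r hKr hr => ?_⟩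
    · exact (Exec.loop_step (by omega) (.seq (.const x 1 s₁) (.seq (.sub L L x t₁)
        (.seq (.const x 0 t₂) (.seq (.add x x L t₃) hs₂)))) hs₃).of_eq
        (by simp only [costLoop]; omega)
    · rw [hr₃ r hKr hr, hr₂ r hKr (by omega), hframe r (by omega) (by omega)]

/-- The abstract state and the machine state need only agree below `K`. The last clause protects the
counters of enclosing loops, which are held in registers from `K` up to `L`. -/
theorem exec_compile (p : Stmt) (K : ℕ) (h : p.Below K) (s s₁ : State) (hs : Agree K s s₁)
    (L : ℕ) (hL : K ≤ L) :
    ∃ s', Exec (p.compile L) s₁ (p.cost s) s' ∧ Agree K (p.run s) s' ∧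
      ∀ r, K ≤ r → r < L → s'.reg r = s₁.reg r := by
  induction p generalizing s s₁ L with
  | skip =>
    refine ⟨_, .const L 0 s₁, hs.setReg_right hL _, fun r _ hr => ?_⟩
    simp [Nat.ne_of_lt hr]
  | set x e =>
    obtain ⟨s₂, hs₂, ha₂, hr₂⟩ := e.exec_compile L s₁ (h.2.mono hL)
    rw [Expr.cost_congr h.2 hs] at hs₂
    rw [Expr.eval_congr h.2 hs] at hr₂
    refine ⟨_, .seq hs₂ (.seq (.const (L + 1) 0 s₂) (.add x L (L + 1) _)), ?_, ?_⟩
    · simp only [run, setReg_reg, if_true, hr₂, if_neg (Nat.ne_of_lt (Nat.lt_succ_self L)),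
        Nat.add_zero]
      exact ((hs.trans (ha₂.mono hL)).setReg_right (by omega) _).setReg x _
    · intro r hKr hr
      have := h.1
      rw [setReg_reg, if_neg (by omega), setReg_reg, if_neg (by omega), ha₂.reg r hr]
  | store a e =>
    obtain ⟨s₂, hs₂, ha₂, hr₂⟩ := a.exec_compile L s₁ (h.1.mono hL)
    rw [Expr.cost_congr h.1 hs] at hs₂
    rw [Expr.eval_congr h.1 hs] at hr₂
    obtain ⟨s₃, hs₃, ha₃, hr₃⟩ := e.exec_compile (L + 1) s₂ (h.2.mono (hL.trans (Nat.le_succ L)))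
    have hs' := hs.trans (ha₂.mono hL)
    rw [Expr.cost_congr h.2 hs'] at hs₃
    rw [Expr.eval_congr h.2 hs'] at hr₃
    rw [← ha₃.reg L (Nat.lt_succ_self L)] at hr₂
    refine ⟨s₃.setMem (s₃.reg L) (s₃.reg (L + 1)), ?_, ?_, ?_⟩
    · simp only [cost, Nat.add_assoc]
      exact .seq hs₂ (.seq hs₃ (.store L (L + 1) s₃))
    · rw [hr₂, hr₃]
      exact (hs'.trans (ha₃.mono (hL.trans (Nat.le_succ L)))).setMem _ _
    · intro r _ hr
      rw [setMem_reg, ha₃.reg r (hr.trans (Nat.lt_succ_self L)), ha₂.reg r hr]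
  | seq p q ihp ihq =>
    obtain ⟨s₂, hs₂, ha₂, hr₂⟩ := ihp h.1 s s₁ hs L hL
    obtain ⟨s₃, hs₃, ha₃, hr₃⟩ := ihq h.2 _ s₂ ha₂ L hL
    exact ⟨s₃, .seq hs₂ hs₃, ha₃, fun r hK hr => (hr₃ r hK hr).trans (hr₂ r hK hr)⟩
  | ite e p q ihp ihq =>
    obtain ⟨s₂, hs₂, ha₂, hr₂⟩ := e.exec_compile L s₁ (h.1.mono hL)
    rw [Expr.cost_congr h.1 hs] at hs₂
    rw [Expr.eval_congr h.1 hs] at hr₂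
    have hs' := hs.trans (ha₂.mono hL)
    simp only [cost, run, Nat.add_assoc]
    by_cases he : e.eval s ≠ 0
    · simp only [if_pos he]
      obtain ⟨s₃, hs₃, ha₃, hr₃⟩ := ihp h.2.1 s s₂ hs' L hL
      exact ⟨s₃, .seq hs₂ (.ite_true (by rwa [hr₂]) hs₃), ha₃,
        fun r hK hr => (hr₃ r hK hr).trans (ha₂.reg r hr)⟩
    · simp only [if_neg he]
      obtain ⟨s₃, hs₃, ha₃, hr₃⟩ := ihq h.2.2 s s₂ hs' L hL
      exact ⟨s₃, .seq hs₂ (.ite_false (by rw [hr₂]; simpa using he) hs₃), ha₃,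
        fun r hK hr => (hr₃ r hK hr).trans (ha₂.reg r hr)⟩
  | loop x e p ih =>
    obtain ⟨s₂, hs₂, ha₂, hr₂⟩ := e.exec_compile L s₁ (h.2.1.mono hL)
    rw [Expr.cost_congr h.2.1 hs] at hs₂
    rw [Expr.eval_congr h.2.1 hs] at hr₂
    obtain ⟨s₃, hs₃, ha₃, hr₃⟩ := exec_loop h.1 hL
      (fun s s₁ hs => ih h.2.2 s s₁ hs (L + 1) (hL.trans (Nat.le_succ L)))
      (e.eval s) s s₂ (hs.trans (ha₂.mono hL)) hr₂
    exact ⟨s₃, .seq hs₂ hs₃, ha₃, fun r hK hr => (hr₃ r hK hr).trans (ha₂.reg r hr)⟩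

/-- From `s`, the statement takes at most `t` steps and leads to a state with the property `Q`. -/
structure Ensures (p : Stmt) (s : State) (t : ℕ) (Q : State → Prop) : Prop where
  cost_le : p.cost s ≤ t
  post : Q (p.run s)

/-! ### Rules for postconditions with time bounds. -/

variable {q : Stmt} {e : Expr} {x t t' : ℕ} {Q R : State → Prop}

theorem Ensures.mono (h : p.Ensures s t Q) (ht : t ≤ t') (hQ : ∀ s', Q s' → R s') :
    p.Ensures s t' R :=
  ⟨h.1.trans ht, hQ _ h.2⟩

theorem Ensures.seq (h : p.Ensures s t R) (h' : ∀ s', R s' → q.Ensures s' t' Q) :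
    (p.seq q).Ensures s (t + t') Q :=
  ⟨Nat.add_le_add h.1 (h' _ h.2).1, (h' _ h.2).2⟩

theorem ensures_skip (h : Q s) : skip.Ensures s 1 Q := ⟨le_rfl, h⟩

theorem ensures_set (ht : e.cost s + 2 ≤ t) (h : Q (s.setReg x (e.eval s))) :
    (set x e).Ensures s t Q := ⟨ht, h⟩

theorem ensures_store {a : Expr} (ht : a.cost s + e.cost s + 1 ≤ t)
    (h : Q (s.setMem (a.eval s) (e.eval s))) : (store a e).Ensures s t Q := ⟨ht, h⟩

theorem ensures_ite {c : ℕ} (hc : e.cost s ≤ c) (hp : e.eval s ≠ 0 → p.Ensures s t Q)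
    (hq : e.eval s = 0 → q.Ensures s t Q) : (ite e p q).Ensures s (c + t + 1) Q := by
  by_cases h : e.eval s = 0
  · have hE := hq h
    refine ⟨?_, ?_⟩
    · rw [cost, if_neg (not_not.2 h)]
      have := hE.1
      omega
    · rw [run, if_neg (not_not.2 h)]
      exact hE.2
  · have hE := hp h
    refine ⟨?_, ?_⟩
    · rw [cost, if_pos h]
      have := hE.1
      omega
    · rw [run, if_pos h]
      exact hE.2

/-- The invariant is indexed by the number of rounds left, since loops count down. -/
theorem ensures_loop {c N : ℕ} (I : ℕ → State → Prop) (hc : e.cost s ≤ c) (hN : e.eval s = N)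
    (h₀ : I N s) (step : ∀ k < N, ∀ s, I (k + 1) s → p.Ensures (s.setReg x k) t (I k)) :
    (loop x e p).Ensures s (c + (N * (t + 5) + 1)) (I 0) := by
  have key : ∀ k ≤ N, ∀ s, I k s →
      costLoop p.run p.cost x k s ≤ k * (t + 5) + 1 ∧ I 0 (runLoop p.run x k s) := by
    intro k
    induction k with
    | zero => exact fun _ s hs => ⟨by simp [costLoop], hs⟩
    | succ k ih =>
      intro hk s hs
      have h := step k hk s hs
      have h' := ih (Nat.le_of_succ_le hk) _ h.2
      refine ⟨?_, h'.2⟩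
      have := h.1
      have := h'.1
      simp only [costLoop, Nat.succ_mul]
      omega
  have := key N le_rfl s h₀
  exact ⟨by simp only [cost, hN]; omega, by simpa only [run, hN] using this.2⟩

end Stmt

end RAM

namespace CDC

open RAM State Stmt

/-! ### The programs

Register `0` holds `d` and register `1` holds `n` throughout. -/

/-- The address of the entry `(x, y)` of the incidence matrix. -/
def cellAddr (x y : ℕ) : Expr := .add (.mul (.var x) (.var 1)) (.var y)

/-- The address of the entry `(x, y)` of the adjacency matrix. -/
def adjAddr (x y : ℕ) : Expr :=
  .add (.mul (.var 0) (.var 1)) (.add (.mul (.var x) (.var 0)) (.var y))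

/-- Put the weight of the edge between the vertices in registers `2` and `3` into register `4`. -/
def weightStmt : Stmt :=
  .seq (.set 4 (.const 0)) <| .loop 5 (.var 1) <| .set 4 <| .add (.var 4) <|
    -- For entries a, b in {0, 1}, the truncated difference a - (1 - b) is the product ab.
    .sub (.load (cellAddr 2 5)) (.sub (.const 1) (.load (cellAddr 3 5)))

/-- The number computed by `weightStmt`. -/
def weightAt (m : ℕ → ℕ) (n i j : ℕ) : ℕ :=
  ∑ v ∈ Finset.range n, (m (i * n + v) - (1 - m (j * n + v)))

/-- A time bound for `weightStmt`. -/
def weightTime {R : Type*} [CommSemiring R] (n : R) : R := 3 + (2 + (n * (6 * n + 40 + 5) + 1))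

theorem ensures_weightStmt {s : State} {n : ℕ} (hn : s.reg 1 = n) :
    weightStmt.Ensures s (weightTime n) fun s' =>
      s'.mem = s.mem ∧ (∀ r, r ≠ 4 → r ≠ 5 → s'.reg r = s.reg r) ∧
        s'.reg 4 = weightAt s.mem n (s.reg 2) (s.reg 3) := by
  let f : ℕ → ℕ := fun v => s.mem (s.reg 2 * n + v) - (1 - s.mem (s.reg 3 * n + v))
  -- The index runs down, so the terms below `k` are the ones still missing from the accumulator.
  let I : ℕ → State → Prop := fun k s' =>
    s'.mem = s.mem ∧ (∀ r, r ≠ 4 → r ≠ 5 → s'.reg r = s.reg r) ∧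
      s'.reg 4 + ∑ v ∈ Finset.range k, f v = ∑ v ∈ Finset.range n, f v
  refine Ensures.seq (R := I n) (ensures_set (by simp [Expr.cost]) ?_) fun s₁ hs₁ => ?_
  · refine ⟨rfl, fun r h₄ _ => by simp [h₄], by simp [Expr.eval]⟩
  · refine (ensures_loop I (c := 2) (N := n) (t := 6 * n + 40) (by simp [Expr.cost])
      (by simp [Expr.eval, hs₁.2.1, hn]) hs₁ ?_).mono le_rfl ?_
    · rintro k - s' ⟨hm, hr, hsum⟩
      have h₁ : s'.reg 1 = n := by rw [hr 1 (by simp) (by simp), hn]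
      have h₂ := hr 2 (by simp) (by simp)
      have h₃ := hr 3 (by simp) (by simp)
      refine ensures_set ?_ ⟨hm, fun r h₄ h₅ => ?_, ?_⟩
      · simp [Expr.cost, Expr.eval, cellAddr, h₁]
        omega
      · simp [h₄, h₅, hr r h₄ h₅]
      · simp only [Expr.eval, cellAddr, setReg_reg, setReg_mem, hm]
        simp only [h₁, h₂, h₃, Nat.reduceEqDiff, if_true, if_false]
        rw [Finset.sum_range_succ] at hsum
        simp only [f] at hsum ⊢
        omega
    · rintro s' ⟨hm, hr, hsum⟩
      exact ⟨hm, hr, by simpa [f, weightAt] using hsum⟩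

/-- Compare twice the weight of the tree plus twice `n` with twice the sum of the cardinalities. -/
def checkStmt : Stmt :=
  .seq (.set 6 (.const 0)) <| .seq (.set 9 (.const 0)) <| .seq
    (.loop 2 (.var 0) <| .seq
      (.loop 3 (.var 0) <| .ite (.load (adjAddr 2 3))
        (.seq weightStmt (.set 6 (.add (.var 6) (.var 4)))) .skip)
      (.loop 5 (.var 1) (.set 9 (.add (.var 9) (.load (cellAddr 2 5))))))
    -- With truncated subtraction, 1 - ((x - y) + (y - x)) is 1 if x = y and 0 otherwise.
    (.set 0 <| .sub (.const 1) <| .add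
      (.sub (.add (.var 6) (.add (.var 1) (.var 1))) (.add (.var 9) (.var 9)))
      (.sub (.add (.var 9) (.var 9)) (.add (.var 6) (.add (.var 1) (.var 1)))))

/-- A time bound for the body of the outer loop of `checkStmt`. -/
def checkRowTime {R : Type*} [CommSemiring R] (d n : R) : R :=
  (2 + (d * (3 * n + 3 * d + 30 + (weightTime n + 7) + 1 + 5) + 1)) +
    (2 + (n * (3 * n + 20 + 5) + 1))

/-- A time bound for `checkStmt`. -/
def checkTime {R : Type*} [CommSemiring R] (d n : R) : R :=
  3 + (3 + ((2 + (d * (checkRowTime d n + 5) + 1)) + 50))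

/-- The contribution of the pair `(i, j)` to twice the weight of the tree. -/
def adjWeightAt (m : ℕ → ℕ) (d n i j : ℕ) : ℕ :=
  if m (d * n + (i * d + j)) ≠ 0 then weightAt m n i j else 0

theorem ensures_checkRow_weight {s : State} {d n : ℕ} (hd : s.reg 0 = d) (hn : s.reg 1 = n) :
    (Stmt.loop 3 (.var 0) <| .ite (.load (adjAddr 2 3))
        (.seq weightStmt (.set 6 (.add (.var 6) (.var 4)))) .skip).Ensures s
      (2 + (d * (3 * n + 3 * d + 30 + (weightTime n + 7) + 1 + 5) + 1)) fun s' =>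
      s'.mem = s.mem ∧ (∀ r, r ≠ 3 → r ≠ 4 → r ≠ 5 → r ≠ 6 → s'.reg r = s.reg r) ∧
      s'.reg 6 = s.reg 6 + ∑ j ∈ Finset.range d, adjWeightAt s.mem d n (s.reg 2) j := by
  let f := adjWeightAt s.mem d n (s.reg 2)
  let I : ℕ → State → Prop := fun k s' =>
    s'.mem = s.mem ∧ (∀ r, r ≠ 3 → r ≠ 4 → r ≠ 5 → r ≠ 6 → s'.reg r = s.reg r) ∧
      s'.reg 6 + ∑ j ∈ Finset.range k, f j = s.reg 6 + ∑ j ∈ Finset.range d, f j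
  refine (ensures_loop I (c := 2) (N := d) (by simp [Expr.cost]) (by simp [Expr.eval, hd])
    ⟨rfl, fun _ _ _ _ _ => rfl, rfl⟩ ?_).mono
    le_rfl ?_
  · rintro k - s' ⟨hm, hr, hsum⟩
    have h₀ : s'.reg 0 = d := by rw [hr 0 (by simp) (by simp) (by simp) (by simp), hd]
    have h₁ : s'.reg 1 = n := by rw [hr 1 (by simp) (by simp) (by simp) (by simp), hn]
    have h₂ := hr 2 (by simp) (by simp) (by simp) (by simp)
    have hadj : (Expr.load (adjAddr 2 3)).eval (s'.setReg 3 k)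
        = s.mem (d * n + (s.reg 2 * d + k)) := by
      simp [Expr.eval, adjAddr, h₀, h₁, h₂, hm]
    rw [Finset.sum_range_succ] at hsum
    refine ensures_ite ?_ ?_ ?_
    · simp [Expr.cost, Expr.eval, adjAddr, h₀, h₁]
      omega
    · intro he
      rw [hadj] at he
      refine ((ensures_weightStmt (n := n) (by simpa using h₁)).seq (t' := 7) ?_)
      rintro s₂ ⟨hm₂, hr₂, hw⟩
      refine ensures_set (by simp [Expr.cost]) ⟨by simpa [hm₂] using hm, ?_, ?_⟩
      · intro r h3 h4 h5 h6
        simp [h6, hr₂ r h4 h5, h3, hr r h3 h4 h5 h6]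
      · have : f k = weightAt s.mem n (s.reg 2) k := by simp [f, adjWeightAt, he]
        simp [Expr.eval, hw, hr₂ 6, hm, h₂]
        omega
    · intro he
      rw [hadj] at he
      refine (ensures_skip ⟨by simpa using hm, ?_, ?_⟩).mono (by omega) fun _ h => h
      · intro r h3 h4 h5 h6
        simp [h3, hr r h3 h4 h5 h6]
      · have : f k = 0 := by simp [f, adjWeightAt, he]
        simp
        omega
  · rintro s' ⟨hm, hr, hsum⟩
    exact ⟨hm, hr, by simpa using hsum⟩

theorem ensures_checkRow_card {s : State} {n : ℕ} (hn : s.reg 1 = n) :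
    (Stmt.loop 5 (.var 1) (.set 9 (.add (.var 9) (.load (cellAddr 2 5))))).Ensures s
      (2 + (n * (3 * n + 20 + 5) + 1)) fun s' =>
      s'.mem = s.mem ∧ (∀ r, r ≠ 5 → r ≠ 9 → s'.reg r = s.reg r) ∧
      s'.reg 9 = s.reg 9 + ∑ v ∈ Finset.range n, s.mem (s.reg 2 * n + v) := by
  let f : ℕ → ℕ := fun v => s.mem (s.reg 2 * n + v)
  let I : ℕ → State → Prop := fun k s' =>
    s'.mem = s.mem ∧ (∀ r, r ≠ 5 → r ≠ 9 → s'.reg r = s.reg r) ∧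
      s'.reg 9 + ∑ v ∈ Finset.range k, f v = s.reg 9 + ∑ v ∈ Finset.range n, f v
  refine (ensures_loop I (c := 2) (N := n) (by simp [Expr.cost]) (by simp [Expr.eval, hn])
    ⟨rfl, fun _ _ _ => rfl, rfl⟩ ?_).mono
    le_rfl ?_
  · rintro k - s' ⟨hm, hr, hsum⟩
    have h₁ : s'.reg 1 = n := by rw [hr 1 (by simp) (by simp), hn]
    have h₂ := hr 2 (by simp) (by simp)
    rw [Finset.sum_range_succ] at hsum
    refine ensures_set ?_ ⟨hm, fun r h5 h9 => by simp [h5, h9, hr r h5 h9], ?_⟩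
    · simp [Expr.cost, Expr.eval, cellAddr, h₁]
      omega
    · simp [Expr.eval, cellAddr, h₁, h₂, hm]
      simp only [f] at hsum ⊢
      omega
  · rintro s' ⟨hm, hr, hsum⟩
    exact ⟨hm, hr, by simpa using hsum⟩

theorem ensures_checkStmt {s : State} {d n : ℕ} (hd : s.reg 0 = d) (hn : s.reg 1 = n) :
    checkStmt.Ensures s (checkTime d n) fun s' => s'.reg 0 =
      if ∑ i ∈ Finset.range d, ∑ j ∈ Finset.range d, adjWeightAt s.mem d n i j + (n + n)
        = ∑ i ∈ Finset.range d, ∑ v ∈ Finset.range n, s.mem (i * n + v) +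
          ∑ i ∈ Finset.range d, ∑ v ∈ Finset.range n, s.mem (i * n + v) then 1 else 0 := by
  let f : ℕ → ℕ := fun i => ∑ j ∈ Finset.range d, adjWeightAt s.mem d n i j
  let g : ℕ → ℕ := fun i => ∑ v ∈ Finset.range n, s.mem (i * n + v)
  let I : ℕ → State → Prop := fun k s' =>
    s'.mem = s.mem ∧ s'.reg 0 = d ∧ s'.reg 1 = n ∧
      s'.reg 6 + ∑ i ∈ Finset.range k, f i = ∑ i ∈ Finset.range d, f i ∧
      s'.reg 9 + ∑ i ∈ Finset.range k, g i = ∑ i ∈ Finset.range d, g i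
  refine Ensures.seq (R := fun s' => s' = s.setReg 6 0) (ensures_set (by simp [Expr.cost]) rfl) ?_
  rintro _ rfl
  refine Ensures.seq (R := I d) (ensures_set (by simp [Expr.cost]) ?_) fun s₁ hs₁ => ?_
  · exact ⟨rfl, by simpa using hd, by simpa using hn, by simp, by simp [Expr.eval]⟩
  refine Ensures.seq (R := I 0) (ensures_loop I (by simp [Expr.cost]) hs₁.2.1 hs₁ ?_)
    fun s₂ hs₂ => ?_
  · rintro k - s' ⟨hm, h₀, h₁, h₆, h₉⟩
    rw [Finset.sum_range_succ] at h₆ h₉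
    refine (ensures_checkRow_weight (by simpa using h₀) (by simpa using h₁)).seq ?_
    rintro s₂ ⟨hm₂, hr₂, hw₂⟩
    have h₁' : s₂.reg 1 = n := by rw [hr₂] <;> simp [h₁]
    refine (ensures_checkRow_card h₁').mono le_rfl ?_
    rintro s₃ ⟨hm₃, hr₃, hw₃⟩
    refine ⟨by simp [hm₃, hm₂, hm], by rw [hr₃, hr₂] <;> simp [h₀], by rw [hr₃, h₁'] <;> simp,
      ?_, ?_⟩
    · rw [hr₃ 6 (by simp) (by simp), hw₂]
      simp [hm]
      simp only [f] at h₆ ⊢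
      omega
    · rw [hw₃, hr₂ 9, hr₂ 2] <;> simp [hm₂, hm]
      simp only [g] at h₉ ⊢
      omega
  · obtain ⟨-, h₀, h₁, h₆, h₉⟩ := hs₂
    refine ensures_set (by simp [Expr.cost]) ?_
    simp only [Finset.range_zero, Finset.sum_empty, Nat.add_zero] at h₆ h₉
    simp only [Expr.eval, setReg_reg, if_true, h₁, h₆, h₉]
    simp only [f, g]
    split_ifs <;> omega

end CDC

/-! ### Prim's algorithm as a program. -/

namespace CDC

open RAM State Stmt

/-- The address of the mark of the vertex `x`. -/
def markAddr (x : ℕ) : Expr :=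
  .add (.mul (.var 0) (.var 1)) (.add (.mul (.var 0) (.var 0)) (.var x))

/-- Make the edge between the vertices in registers `2` and `3` the best edge, if it is better than
the best edge known. -/
def improveStmt : Stmt :=
  .ite (.sub (.load (markAddr 2)) (.load (markAddr 3)))
    -- Weights are stored plus one, so that zero means that no edge has been found and edges of
    -- weight zero still count.
    (.seq weightStmt <| .ite (.sub (.add (.var 4) (.const 1)) (.var 6))
      (.seq (.set 6 (.add (.var 4) (.const 1))) (.seq (.set 7 (.var 2)) (.set 8 (.var 3))))
      .skip)
    .skip

/-- Find an edge of largest weight between a marked and an unmarked vertex. -/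
def searchStmt : Stmt :=
  .seq (.set 6 (.const 0)) <| .loop 2 (.var 0) <| .loop 3 (.var 0) improveStmt

/-- Prim's algorithm. -/
def mstStmt : Stmt :=
  -- This cell is the mark of vertex 0, from which the tree grows.
  .seq (.store (.add (.mul (.var 0) (.var 1)) (.mul (.var 0) (.var 0))) (.const 1)) <|
    -- One round more than needed: once all vertices are marked, the search leaves register 6 at
    -- zero and the round does nothing.
    .loop 10 (.var 0) <| .seq searchStmt <| .ite (.var 6)
      (.seq (.store (adjAddr 7 8) (.const 1)) <| .seq (.store (adjAddr 8 7) (.const 1)) <|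
        .store (markAddr 8) (.const 1))
      .skip

/-- A time bound for `improveStmt`. -/
def improveTime {R : Type*} [CommSemiring R] (d n : R) : R :=
  6 * n + 6 * d + 50 + (weightTime n + (7 + 14 + 1)) + 1

/-- A time bound for `searchStmt`. -/
def searchTime {R : Type*} [CommSemiring R] (d n : R) : R :=
  3 + (2 + (d * ((2 + (d * (improveTime d n + 5) + 1)) + 5) + 1))

/-- A time bound for `mstStmt`. -/
def mstTime {R : Type*} [CommSemiring R] (d n : R) : R :=
  (3 * n + 3 * d + 30) + (2 + (d * ((searchTime d n +
    (2 + ((3 * n + 3 * d + 40) + ((3 * n + 3 * d + 40) + (3 * n + 3 * d + 40))) + 1)) + 5) + 1))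

/-- `i` is marked and `j` is not. -/
def Crossing (m : ℕ → ℕ) (d n i j : ℕ) : Prop :=
  m (d * n + (d * d + i)) - m (d * n + (d * d + j)) ≠ 0

/-- Register `6` is zero, or registers `7` and `8` hold a crossing pair and register `6` holds its
weight plus one. No crossing pair in `P` is better. -/
structure HoldsBest (m : ℕ → ℕ) (d n : ℕ) (P : ℕ → ℕ → Prop) (s : State) : Prop where
  mem : s.mem = m
  reg_zero : s.reg 0 = d
  reg_one : s.reg 1 = n
  lt_of_crossing : ∀ i j, P i j → Crossing m d n i j → weightAt m n i j < s.reg 6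
  of_ne_zero : s.reg 6 ≠ 0 → s.reg 7 < d ∧ s.reg 8 < d ∧ Crossing m d n (s.reg 7) (s.reg 8) ∧
    s.reg 6 = weightAt m n (s.reg 7) (s.reg 8) + 1

variable {m : ℕ → ℕ} {d n : ℕ} {P P' : ℕ → ℕ → Prop} {s s' : State}

theorem HoldsBest.mono (h : HoldsBest m d n P s) (hP : ∀ i j, P' i j → P i j) :
    HoldsBest m d n P' s :=
  ⟨h.mem, h.reg_zero, h.reg_one, fun i j hij => h.lt_of_crossing i j (hP i j hij), h.of_ne_zero⟩

theorem HoldsBest.congr (h : HoldsBest m d n P s) (hm : s'.mem = s.mem)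
    (hr : ∀ r, r ≠ 2 → r ≠ 3 → r ≠ 4 → r ≠ 5 → s'.reg r = s.reg r) : HoldsBest m d n P s' := by
  have h₀ := hr 0 (by simp) (by simp) (by simp) (by simp)
  have h₁ := hr 1 (by simp) (by simp) (by simp) (by simp)
  have h₆ := hr 6 (by simp) (by simp) (by simp) (by simp)
  have h₇ := hr 7 (by simp) (by simp) (by simp) (by simp)
  have h₈ := hr 8 (by simp) (by simp) (by simp) (by simp)
  exact ⟨hm.trans h.mem, h₀.trans h.reg_zero, h₁.trans h.reg_one,
    by rw [h₆]; exact h.lt_of_crossing, by rw [h₆, h₇, h₈]; exact h.of_ne_zero⟩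

theorem HoldsBest.insert (h : HoldsBest m d n P s) {i j : ℕ}
    (hij : Crossing m d n i j → weightAt m n i j < s.reg 6) :
    HoldsBest m d n (fun i' j' => P i' j' ∨ (i' = i ∧ j' = j)) s :=
  ⟨h.mem, h.reg_zero, h.reg_one, by
    rintro i' j' (hP | ⟨rfl, rfl⟩)
    exacts [h.lt_of_crossing i' j' hP, hij], h.of_ne_zero⟩

theorem ensures_improveStmt (h : HoldsBest m d n P s) (hi : s.reg 2 < d) (hj : s.reg 3 < d) :
    improveStmt.Ensures s (improveTime d n) fun s' =>
      HoldsBest m d n (fun i j => P i j ∨ (i = s.reg 2 ∧ j = s.reg 3)) s' ∧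
        s'.reg 2 = s.reg 2 := by
  have hcross : (Expr.sub (.load (markAddr 2)) (.load (markAddr 3))).eval s ≠ 0 ↔
      Crossing m d n (s.reg 2) (s.reg 3) := by
    simp only [Expr.eval, markAddr, h.reg_zero, h.reg_one, h.mem, Crossing]
  refine ensures_ite ?_ ?_ ?_
  · simp [Expr.cost, Expr.eval, markAddr, h.reg_zero, h.reg_one]
    omega
  · intro he
    rw [hcross] at he
    refine (ensures_weightStmt h.reg_one).seq ?_
    rintro s₁ ⟨hm₁, hr₁, hw⟩
    rw [h.mem] at hw
    have h₂ : s₁.reg 2 = s.reg 2 := hr₁ 2 (by simp) (by simp)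
    have h₃ : s₁.reg 3 = s.reg 3 := hr₁ 3 (by simp) (by simp)
    have hB : HoldsBest m d n P s₁ := h.congr hm₁ fun r _ _ h4 h5 => hr₁ r h4 h5
    refine ensures_ite (by simp [Expr.cost]) ?_ ?_
    · intro hlt
      simp only [Expr.eval] at hlt
      refine Ensures.seq (R := fun s' => s' = s₁.setReg 6 (s₁.reg 4 + 1)) (t := 6) (t' := 8)
        (ensures_set (by simp [Expr.cost]) rfl) ?_
      rintro _ rfl
      refine Ensures.seq (R := fun s' => s' = (s₁.setReg 6 (s₁.reg 4 + 1)).setReg 7 (s.reg 2))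
        (t := 4) (t' := 4) (ensures_set (by simp [Expr.cost]) (by simp [Expr.eval, h₂])) ?_
      rintro _ rfl
      refine ensures_set (by simp [Expr.cost]) ⟨⟨hB.mem, ?_, ?_, ?_, ?_⟩, ?_⟩
      · simpa using hB.reg_zero
      · simpa using hB.reg_one
      · rintro i j (hP | ⟨rfl, rfl⟩) hc
        · have := hB.lt_of_crossing i j hP hc
          simp
          omega
        · simp [hw]
      · intro _
        simp [Expr.eval, h₃, hw]
        exact ⟨hi, hj, he⟩
      · simp [h₂]
    · intro hle
      simp only [Expr.eval] at hle
      refine (ensures_skip ⟨hB.insert fun _ => ?_, h₂⟩).mono (by omega) fun _ h => h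
      omega
  · intro he
    have he' : ¬ Crossing m d n (s.reg 2) (s.reg 3) := by rw [← hcross]; simpa using he
    exact (ensures_skip ⟨h.insert fun hc => absurd hc he', rfl⟩).mono (by omega) fun _ h => h

theorem ensures_searchStmt (hm : s.mem = m) (hd : s.reg 0 = d) (hn : s.reg 1 = n) :
    searchStmt.Ensures s (searchTime d n) (HoldsBest m d n fun i j => i < d ∧ j < d) := by
  let I : ℕ → State → Prop := fun k => HoldsBest m d n fun i j => k ≤ i ∧ i < d ∧ j < d
  refine Ensures.seq (R := I d) (ensures_set (by simp [Expr.cost]) ?_) fun s₁ hs₁ => ?_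
  · refine ⟨hm, by simpa using hd, by simpa using hn, fun i j h => by omega, ?_⟩
    intro h
    simp [Expr.eval] at h
  refine (ensures_loop I (c := 2) (N := d) (by simp [Expr.cost])
    (by simp [Expr.eval, hs₁.reg_zero]) hs₁ ?_).mono le_rfl fun s' hs' => hs'.mono (by simp)
  intro i hi s₂ hs₂
  -- Both indices run down: the rows above `i` are finished, and row `i` is finished from column `l`
  -- on.
  let J : ℕ → State → Prop := fun l s' =>
    HoldsBest m d n (fun i' j' => (i + 1 ≤ i' ∧ i' < d ∧ j' < d) ∨ (i' = i ∧ l ≤ j' ∧ j' < d)) s' ∧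
      s'.reg 2 = i
  refine (ensures_loop J (c := 2) (N := d) (t := improveTime d n) (by simp [Expr.cost])
    (by simp [Expr.eval, hs₂.reg_zero]) ⟨?_, by simp⟩ ?_).mono le_rfl fun s' hs' => ?_
  · exact (hs₂.congr (s' := s₂.setReg 2 i) rfl fun r h2 _ _ _ => by simp [h2]).mono
      fun i' j' h => by omega
  · rintro j hj s₃ ⟨hs₃, hr₃⟩
    refine (ensures_improveStmt (s := s₃.setReg 3 j)
      (hs₃.congr rfl fun r _ h3 _ _ => by simp [h3]) (by simpa [hr₃] using hi)
      (by simpa using hj)).mono le_rfl ?_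
    rintro s₄ ⟨hs₄, hr₄⟩
    refine ⟨hs₄.mono fun i' j' h => ?_, by simpa [hr₃] using hr₄⟩
    simp [hr₃]
    omega
  · exact hs'.1.mono fun i' j' h => by omega

end CDC

/-! ### Memory contents and the correctness of both programs. -/

namespace CDC

open RAM State Stmt

variable {α : Type*} [DecidableEq α] {d n : ℕ} {S : Fin d → Finset α}
  {e : Fin n ≃ ↥(Finset.univ.biUnion S)} {m m' : ℕ → ℕ}

theorem _root_.RAM.truthValue_ne_zero {p : Prop} : truthValue p ≠ 0 ↔ p := by
  simp [truthValue]

theorem _root_.RAM.truthValue_of_true {p : Prop} (h : p) : truthValue p = 1 := by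
  simp [truthValue, h]

theorem _root_.RAM.truthValue_of_false {p : Prop} (h : ¬ p) : truthValue p = 0 := by
  simp [truthValue, h]

theorem mul_add_inj {i i' j j' b : ℕ} (hj : j < b) (hj' : j' < b) :
    i * b + j = i' * b + j' ↔ i = i' ∧ j = j' := by
  refine ⟨fun h => ?_, by rintro ⟨rfl, rfl⟩; rfl⟩
  have hb : 0 < b := by omega
  have h₁ := congrArg (· / b) h
  simp only [Nat.mul_comm _ b, Nat.mul_add_div hb, Nat.div_eq_of_lt hj, Nat.div_eq_of_lt hj'] at h₁
  have : i = i' := by omega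
  subst this
  omega

theorem mul_add_lt {i j a b : ℕ} (hi : i < a) (hj : j < b) : i * b + j < a * b :=
  calc i * b + j < (i + 1) * b := by rw [Nat.succ_mul]; omega
    _ ≤ a * b := Nat.mul_le_mul_right b hi

/-- The memory starts with the incidence matrix. -/
def HoldsFamily (m : ℕ → ℕ) (S : Fin d → Finset α) (e : Fin n ≃ ↥(Finset.univ.biUnion S)) : Prop :=
  ∀ (i : Fin d) (j : Fin n), m ((i : ℕ) * n + (j : ℕ)) = truthValue ((e j : α) ∈ S i)

theorem sum_truthValue_mem (e : Fin n ≃ ↥(Finset.univ.biUnion S)) {A : Finset α}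
    (hA : A ⊆ Finset.univ.biUnion S) : ∑ v, truthValue ((e v : α) ∈ A) = A.card := by
  classical
  rw [Equiv.sum_comp e fun x => truthValue ((x : α) ∈ A),
    Finset.sum_coe_sort (Finset.univ.biUnion S) fun x => truthValue (x ∈ A)]
  have : ∀ x, truthValue (x ∈ A) = if x ∈ A then 1 else 0 := fun x => by simp [truthValue]
  simp only [this, Finset.sum_ite_mem, Finset.inter_eq_right.2 hA, Finset.card_eq_sum_ones]

theorem HoldsFamily.sum_row (h : HoldsFamily m S e) (i : Fin d) :
    ∑ v ∈ Finset.range n, m (i * n + v) = (S i).card := by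
  rw [Finset.sum_range, ← sum_truthValue_mem e (Finset.subset_biUnion_of_mem S (Finset.mem_univ i))]
  exact Finset.sum_congr rfl fun v _ => h i v

theorem HoldsFamily.weightAt (h : HoldsFamily m S e) (i j : Fin d) :
    weightAt m n i j = (S i ∩ S j).card := by
  rw [CDC.weightAt, Finset.sum_range, ← sum_truthValue_mem e (A := S i ∩ S j)
    (Finset.inter_subset_left.trans (Finset.subset_biUnion_of_mem S (Finset.mem_univ i)))]
  refine Finset.sum_congr rfl fun v _ => ?_
  rw [h i v, h j v]
  by_cases hi : (e v : α) ∈ S i <;> by_cases hj : (e v : α) ∈ S j <;> simp [truthValue, hi, hj]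

theorem card_biUnion_eq (e : Fin n ≃ ↥(Finset.univ.biUnion S)) :
    (Finset.univ.biUnion S).card = n := by
  simpa using (Fintype.card_congr e).symm

-- The program tests twice the equality of `separationCondition_iff_weight`, with n as the size of
-- the union.
open Classical in
theorem ensures_checkStmt_separation {T : SimpleGraph (Fin d)} {s : State}
    (hT : IsSpanningTree S T) (hs : HoldsFamilyAndTree s S e T) :
    checkStmt.Ensures s (checkTime d n) fun s' =>
      s'.reg 0 = truthValue (SeparationCondition S T) := by
  obtain ⟨hd, hn, hfam, htree⟩ := hs
  have hfam : HoldsFamily s.mem S e := hfam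
  refine (ensures_checkStmt hd hn).mono le_rfl fun s' hs' => ?_
  have h₁ : ∑ i ∈ Finset.range d, ∑ j ∈ Finset.range d, adjWeightAt s.mem d n i j
      = 2 * weight S T := by
    rw [weight, ← SimpleGraph.sum_sum_adj, Finset.sum_range]
    refine Finset.sum_congr rfl fun i _ => ?_
    rw [Finset.sum_range]
    refine Finset.sum_congr rfl fun j _ => ?_
    rw [adjWeightAt, htree, hfam.weightAt, mid_mk]
    simp only [truthValue_ne_zero]
  have h₂ : ∑ i ∈ Finset.range d, ∑ v ∈ Finset.range n, s.mem (i * n + v)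
      = ∑ i, (S i).card := by
    rw [Finset.sum_range]
    exact Finset.sum_congr rfl fun i _ => hfam.sum_row i
  rw [hs', h₁, h₂, separationCondition_iff_weight hT, card_biUnion_eq e, truthValue]
  congr 1
  simp only [eq_iff_iff]
  omega

/-- The memory holds the incidence matrix, the adjacency matrix of `F` and the marks of `U`. -/
structure HoldsForest (m : ℕ → ℕ) (S : Fin d → Finset α) (e : Fin n ≃ ↥(Finset.univ.biUnion S))
    (U : Set (Fin d)) (F : SimpleGraph (Fin d)) : Prop where
  family : HoldsFamily m S e
  tree : ∀ i j : Fin d, m (d * n + ((i : ℕ) * d + (j : ℕ))) = truthValue (F.Adj i j)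
  mark : ∀ i : Fin d, m (d * n + (d * d + (i : ℕ))) = truthValue (i ∈ U)

/-- The input memory is zero beyond the incidence matrix, which already encodes the empty graph
without marks. -/
theorem holdsForest_inputState (hd : 0 < d) :
    HoldsForest ((inputState S e).setMem (d * n + d * d) 1).mem S e {⟨0, hd⟩} ⊥ where
  family i j := by
    have := mul_add_lt i.2 j.2
    rw [setMem_mem, if_neg (by omega), inputState]
    refine congrArg truthValue (propext ⟨?_, fun h => ⟨i, j, rfl, h⟩⟩)
    · rintro ⟨i', j', h, h'⟩
      obtain ⟨hi, hj⟩ := (mul_add_inj j.2 j'.2).1 h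
      rwa [Fin.ext hi, Fin.ext hj]
  tree i j := by
    have := mul_add_lt i.2 j.2
    rw [setMem_mem, if_neg (by omega), inputState,
      truthValue_of_false (p := SimpleGraph.Adj ⊥ i j) (by simp)]
    refine truthValue_of_false ?_
    rintro ⟨i', j', h, -⟩
    have := mul_add_lt i'.2 j'.2
    omega
  mark i := by
    rw [setMem_mem]
    split_ifs with h
    · rw [truthValue_of_true]
      exact Fin.ext (by simp; omega)
    · rw [truthValue_of_false (p := i ∈ _) (by rintro rfl; simp at h)]
      refine truthValue_of_false ?_
      rintro ⟨i', j', h, -⟩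
      have := mul_add_lt i'.2 j'.2
      omega

/-- The incidence matrix, the adjacency matrix and the marks occupy disjoint address ranges, so each
of the three writes affects only its own table. -/
theorem HoldsForest.insert {U : Set (Fin d)} {F : SimpleGraph (Fin d)}
    (h : HoldsForest m S e U F) {a b : Fin d} (hab : a ≠ b)
    (hm' : ∀ x, m' x = if x = d * n + (d * d + b) then 1 else if x = d * n + (b * d + a) then 1
      else if x = d * n + (a * d + b) then 1 else m x) :
    HoldsForest m' S e (insert b U) (F ⊔ SimpleGraph.edge a b) where
  family i j := by
    have := mul_add_lt i.2 j.2
    rw [hm', if_neg (by omega), if_neg (by omega), if_neg (by omega), h.family]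
  tree i j := by
    have := mul_add_lt i.2 j.2
    rw [hm', if_neg (by omega), h.tree]
    simp only [Nat.add_left_cancel_iff, mul_add_inj j.2 a.2, mul_add_inj j.2 b.2, Fin.val_inj,
      SimpleGraph.sup_adj, SimpleGraph.edge_adj, truthValue]
    have := F.ne_of_adj (a := i) (b := j)
    split_ifs <;> grind
  mark i := by
    have h₁ := mul_add_lt a.2 b.2
    have h₂ := mul_add_lt b.2 a.2
    rw [hm', if_neg (c := _ = d * n + (b * d + a)) (by omega),
      if_neg (c := _ = d * n + (a * d + b)) (by omega), h.mark]
    simp only [Nat.add_left_cancel_iff, Fin.val_inj, truthValue, Set.mem_insert_iff]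
    split_ifs <;> grind

theorem HoldsForest.crossing_iff {U : Set (Fin d)} {F : SimpleGraph (Fin d)}
    (h : HoldsForest m S e U F) (i j : Fin d) : Crossing m d n i j ↔ i ∈ U ∧ j ∉ U := by
  rw [Crossing, h.mark, h.mark]
  by_cases hi : i ∈ U <;> by_cases hj : j ∈ U <;> simp [truthValue, hi, hj]

/-- The invariant of the outer loop of `mstStmt`, with `k` rounds left. -/
def MstInvariant (S : Fin d → Finset α) (e : Fin n ≃ ↥(Finset.univ.biUnion S)) (k : ℕ)
    (s : State) : Prop :=
  s.reg 0 = d ∧ s.reg 1 = n ∧ ∃ (U : Set (Fin d)) (F : SimpleGraph (Fin d)),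
    HoldsForest s.mem S e U F ∧ PrimInvariant S U F ∧ U.Nonempty ∧ d ≤ U.ncard + k

theorem ensures_mstStmt_body {k : ℕ} {s : State} (hs : MstInvariant S e (k + 1) s) :
    (searchStmt.seq <| .ite (.var 6)
      (.seq (.store (adjAddr 7 8) (.const 1)) <| .seq (.store (adjAddr 8 7) (.const 1)) <|
        .store (markAddr 8) (.const 1)) .skip).Ensures s
      (searchTime d n +
        (2 + ((3 * n + 3 * d + 40) + ((3 * n + 3 * d + 40) + (3 * n + 3 * d + 40))) + 1))
      (MstInvariant S e k) := by
  obtain ⟨hd, hn, U, F, hF, hprim, ⟨r, hr⟩, hcard⟩ := hs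
  refine (ensures_searchStmt rfl hd hn).seq fun s₁ hs₁ => ?_
  have h₀ := hs₁.reg_zero
  have h₁ := hs₁.reg_one
  refine ensures_ite (by simp [Expr.cost]) ?_ ?_
  · intro hne
    obtain ⟨ha, hb, hc, hw⟩ := hs₁.of_ne_zero hne
    obtain ⟨a, ha'⟩ : ∃ a : Fin d, s₁.reg 7 = a := ⟨⟨_, ha⟩, rfl⟩
    obtain ⟨b, hb'⟩ : ∃ b : Fin d, s₁.reg 8 = b := ⟨⟨_, hb⟩, rfl⟩
    rw [ha', hb'] at hc hw
    rw [hF.crossing_iff] at hc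
    have hab : a ≠ b := fun h => hc.2 (h ▸ hc.1)
    have hmax : ∀ x ∈ U, ∀ y ∉ U, (S x ∩ S y).card ≤ (S a ∩ S b).card := by
      intro x hx y hy
      have := hs₁.lt_of_crossing x y ⟨x.2, y.2⟩ ((hF.crossing_iff x y).2 ⟨hx, hy⟩)
      rw [hw, hF.family.weightAt, hF.family.weightAt] at this
      omega
    let s₂ := s₁.setMem (d * n + (a * d + b)) 1
    let s₃ := s₂.setMem (d * n + (b * d + a)) 1
    let s₄ := s₃.setMem (d * n + (d * d + b)) 1
    refine Ensures.seq (R := fun s' => s' = s₂) (ensures_store ?_ ?_) ?_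
    · simp [Expr.cost, Expr.eval, adjAddr, h₀, h₁]
      omega
    · simp [Expr.eval, adjAddr, h₀, h₁, ha', hb', s₂]
    rintro _ rfl
    refine Ensures.seq (R := fun s' => s' = s₃) (ensures_store ?_ ?_) ?_
    · simp [Expr.cost, Expr.eval, adjAddr, h₀, h₁, s₂]
      omega
    · simp [Expr.eval, adjAddr, h₀, h₁, ha', hb', s₃, s₂]
    rintro _ rfl
    refine (ensures_store (Q := fun s' => s' = s₄) ?_ ?_).mono le_rfl ?_
    · simp [Expr.cost, Expr.eval, markAddr, h₀, h₁, s₃, s₂]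
      omega
    · simp [Expr.eval, markAddr, h₀, h₁, hb', s₄, s₃, s₂]
    rintro _ rfl
    refine ⟨h₀, h₁, Insert.insert b U, F ⊔ SimpleGraph.edge a b, hF.insert hab fun x => ?_,
      hprim.insert hc.1 hc.2 hmax, ⟨b, .inl rfl⟩, ?_⟩
    · simp only [s₄, s₃, s₂, setMem_mem, hs₁.mem]
    · rw [Set.ncard_insert_of_notMem hc.2]
      omega
  · intro hz
    refine (ensures_skip ⟨h₀, h₁, U, F, by rwa [hs₁.mem], hprim, ⟨r, hr⟩, ?_⟩).mono (by omega)
      fun _ h => h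
    -- An unmarked vertex would form a crossing pair with `r`, whose weight would have to be below
    -- register 6, which is zero.
    have hU : U = Set.univ := by
      rw [Set.eq_univ_iff_forall]
      by_contra! hy
      obtain ⟨y, hy⟩ := hy
      have := hs₁.lt_of_crossing r y ⟨r.2, y.2⟩ ((hF.crossing_iff r y).2 ⟨hr, hy⟩)
      simp only [Expr.eval] at hz
      omega
    rw [hU, Set.ncard_univ, Nat.card_eq_fintype_card, Fintype.card_fin]
    omega

theorem MstInvariant.setReg {k : ℕ} {s : State} (h : MstInvariant S e k s) {x : ℕ} (hx : 1 < x)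
    (v : ℕ) : MstInvariant S e k (s.setReg x v) := by
  obtain ⟨h₀, h₁, h⟩ := h
  refine ⟨?_, ?_, h⟩
  · rwa [setReg_reg, if_neg (by omega)]
  · rwa [setReg_reg, if_neg (by omega)]

theorem ensures_mstStmt (hd : 0 < d) :
    mstStmt.Ensures (inputState S e) (mstTime d n) fun s =>
      ∃ T, HoldsFamilyAndTree s S e T ∧ IsMaxSpanningTree S T := by
  have h₀ : (inputState S e).reg 0 = d := by simp [inputState]
  have h₁ : (inputState S e).reg 1 = n := by simp [inputState]
  refine Ensures.seq (R := MstInvariant S e d) (ensures_store ?_ ?_) fun s hs => ?_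
  · simp [Expr.cost, Expr.eval, h₀, h₁]
    omega
  · simp only [Expr.eval, h₀, h₁]
    exact ⟨h₀, h₁, _, _, holdsForest_inputState hd, .singleton S _, Set.singleton_nonempty _,
      by simp⟩
  refine (ensures_loop (MstInvariant S e) (c := 2) (N := d) (by simp [Expr.cost])
    (by simp [Expr.eval, hs.1]) hs
    fun k _ s hs => ensures_mstStmt_body (hs.setReg (by simp) k)).mono le_rfl ?_
  rintro s ⟨hd', hn, U, F, hF, hprim, -, hcard⟩
  have hU : U = Set.univ := by
    refine Set.eq_of_subset_of_ncard_le (Set.subset_univ U) ?_ (Set.toFinite _)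
    rw [Set.ncard_univ, Nat.card_eq_fintype_card, Fintype.card_fin]
    omega
  subst hU
  have : Nonempty (Fin d) := ⟨⟨0, hd⟩⟩
  exact ⟨F, ⟨hd', hn, hF.family, hF.tree⟩, hprim.isMaxSpanningTree⟩

/-- The programs use registers 0 to 10; intermediate results start at 11. -/
theorem below_mstStmt : mstStmt.Below 11 := by
  simp [mstStmt, searchStmt, improveStmt, weightStmt, markAddr, adjAddr, cellAddr, Stmt.Below,
    Expr.Below]

theorem below_checkStmt : checkStmt.Below 11 := by
  simp [checkStmt, weightStmt, adjAddr, cellAddr, Stmt.Below, Expr.Below]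

end CDC

/-! ### The main theorem. -/

theorem mainTheorem6 :
    ∃ (mst check : RAM.Prog) (P : MvPolynomial (Fin 2) ℕ),
      ∀ (α : Type*) [DecidableEq α] (d n : ℕ) (_hd : 0 < d) (S : Fin d → Finset α)
        (e : Fin n ≃ ↥(Finset.univ.biUnion S)),
        -- `mst` followed by `check` decides in polynomial time whether there is a junction tree
        (∃ (t : ℕ) (s : RAM.State),
          RAM.Exec (RAM.Prog.seq mst check) (CDC.inputState S e) t s ∧
          t ≤ MvPolynomial.eval ![d, n] P ∧
          s.reg 0 = RAM.truthValue (CDC.AdmitsJunctionTree S)) ∧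
        -- `mst` computes one maximum spanning tree of the intersection graph
        (∃ (t : ℕ) (s : RAM.State) (T : SimpleGraph (Fin d)),
          RAM.Exec mst (CDC.inputState S e) t s ∧
          t ≤ MvPolynomial.eval ![d, n] P ∧
          CDC.HoldsFamilyAndTree s S e T ∧ CDC.IsMaxSpanningTree S T) ∧
        -- `check` checks the separation condition for a given spanning tree
        (∀ (T : SimpleGraph (Fin d)) (s : RAM.State),
          CDC.IsSpanningTree S T → CDC.HoldsFamilyAndTree s S e T →
          ∃ (t : ℕ) (s' : RAM.State),
            RAM.Exec check s t s' ∧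
            t ≤ MvPolynomial.eval ![d, n] P ∧
            s'.reg 0 = RAM.truthValue (CDC.SeparationCondition S T)) ∧
        -- whichever maximum spanning tree is used, the separation condition gives the answer
        (∀ T : SimpleGraph (Fin d), CDC.IsMaxSpanningTree S T →
          (CDC.AdmitsJunctionTree S ↔ CDC.SeparationCondition S T)) := by
  refine ⟨CDC.mstStmt.compile 11, CDC.checkStmt.compile 11,
    -- The time bounds make sense over any commutative semiring: at the variables they give the
    -- polynomial, at `d` and `n` the number of steps allowed.
    CDC.mstTime (MvPolynomial.X 0) (MvPolynomial.X 1) +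
      CDC.checkTime (MvPolynomial.X 0) (MvPolynomial.X 1), ?_⟩
  intro α _ d n hd S e
  have htime : MvPolynomial.eval ![d, n] (CDC.mstTime (MvPolynomial.X 0) (MvPolynomial.X 1) +
      CDC.checkTime (MvPolynomial.X 0) (MvPolynomial.X 1))
        = CDC.mstTime d n + CDC.checkTime d n := by
    simp [CDC.mstTime, CDC.checkTime, CDC.searchTime, CDC.improveTime, CDC.weightTime,
      CDC.checkRowTime]
  rw [htime]
  have hmst : ∃ (t : ℕ) (s : RAM.State) (T : SimpleGraph (Fin d)),
      RAM.Exec (CDC.mstStmt.compile 11) (CDC.inputState S e) t s ∧ t ≤ CDC.mstTime d n ∧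
      CDC.HoldsFamilyAndTree s S e T ∧ CDC.IsMaxSpanningTree S T := by
    obtain ⟨hc, T, hT, hmax⟩ := CDC.ensures_mstStmt (e := e) hd
    obtain ⟨s, hs, ha, -⟩ :=
      CDC.mstStmt.exec_compile 11 CDC.below_mstStmt _ _ (.refl _ _) 11 le_rfl
    refine ⟨_, s, T, hs, hc, ?_, hmax⟩
    obtain ⟨h₀, h₁, hfam, htree⟩ := hT
    exact ⟨by rw [ha.reg 0 (by simp), h₀], by rw [ha.reg 1 (by simp), h₁],
      by rwa [ha.mem], by rwa [ha.mem]⟩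
  have hcheck : ∀ (T : SimpleGraph (Fin d)) (s : RAM.State),
      CDC.IsSpanningTree S T → CDC.HoldsFamilyAndTree s S e T →
      ∃ (t : ℕ) (s' : RAM.State), RAM.Exec (CDC.checkStmt.compile 11) s t s' ∧
        t ≤ CDC.checkTime d n ∧ s'.reg 0 = RAM.truthValue (CDC.SeparationCondition S T) := by
    intro T s hT hs
    obtain ⟨hc, hr⟩ := CDC.ensures_checkStmt_separation hT hs
    obtain ⟨s', hs', ha, -⟩ :=
      CDC.checkStmt.exec_compile 11 CDC.below_checkStmt _ _ (.refl _ s) 11 le_rfl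
    exact ⟨_, s', hs', hc, by rw [ha.reg 0 (by simp), hr]⟩
  refine ⟨?_, ?_, fun T s hT hs => ?_, fun T hT => hT.admitsJunctionTree_iff⟩
  · obtain ⟨t, s, T, hs, ht, hT, hmax⟩ := hmst
    obtain ⟨t', s', hs', ht', hr⟩ := hcheck T s hmax.1 hT
    exact ⟨_, s', .seq hs hs', Nat.add_le_add ht ht', by rw [hr, hmax.admitsJunctionTree_iff]⟩
  · obtain ⟨t, s, T, hs, ht, h⟩ := hmst
    exact ⟨t, s, T, hs, by omega, h⟩
  · obtain ⟨t, s', hs', ht, h⟩ := hcheck T s hT hs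
    exact ⟨t, s', hs', by omega, h⟩
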